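/- Let $d\ge 3$ and let $v\in L^1(\mathbb R^d)\cap L^\infty(\mathbb R^d)$ be real-valued with $v\ge 0$ almost everywhere. For $L>0$ let $\Lambda_L=\left(-\tfrac L2,\tfrac L2\right)^d$ and let $h_L=-\Delta+v$ be the Schrödinger operator with Dirichlet boundary conditions in the complex Hilbert space $L^2(\Lambda_L)$, with domain $H^1_0(\Lambda_L)\cap H^2(\Lambda_L)$. Let $\lambda_0(L)\le\lambda_1(L)\le\dots$ denote the eigenvalues of $h_L$, in nondecreasing order and counted with multiplicity, and let $\Gamma_v(L)=\lambda_1(L)-\lambda_0(L)$ be the spectral gap. Then there are constants $\alpha,\beta>0$ and $L_0>0$ (which may depend on $d$ and $v$) such that for all $L\ge L_0$ the two lowest eigenvalues $\lambda_0(L)$ and $\lambda_1(L)$ exist and $$\frac{\alpha}{L^2}\;\le\;\Gamma_v(L)\;\le\;\frac{\beta}{L^2}.$$ -/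

import Mathlib

open MeasureTheory Filter Topology
open scoped ENNReal ContDiff

namespace SpectralGap

/-- The open cube `(-L/2, L/2)^d` in `ℝ^d`. -/
def cube (d : ℕ) (L : ℝ) : Set (EuclideanSpace ℝ (Fin d)) :=
  {x | ∀ i, -(L / 2) < x i ∧ x i < L / 2}

theorem isOpen_cube (d : ℕ) (L : ℝ) : IsOpen (cube d L) := by
  have h : cube d L = ⋂ i : Fin d, {x | -(L / 2) < x i ∧ x i < L / 2} := by
    ext x; simp [cube]
  rw [h]
  refine isOpen_iInter_of_finite fun i => ?_
  have hc : Continuous fun x : EuclideanSpace ℝ (Fin d) => x i := by fun_prop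
  exact (isOpen_lt continuous_const hc).inter (isOpen_lt hc continuous_const)

/-- The complex Hilbert space `L²(Ω)`, with Lebesgue measure on `Ω ⊆ ℝ^d`. -/
abbrev L2 {d : ℕ} (Ω : Set (EuclideanSpace ℝ (Fin d))) : Type :=
  Lp ℂ 2 ((volume : Measure (EuclideanSpace ℝ (Fin d))).restrict Ω)

/-- `φ ∈ C_c^∞(Ω)`. -/
structure IsTestFunction {d : ℕ} (Ω : Set (EuclideanSpace ℝ (Fin d)))
    (φ : EuclideanSpace ℝ (Fin d) → ℂ) : Prop where
  smooth : ContDiff ℝ ∞ φ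
  compact : HasCompactSupport φ
  support : tsupport φ ⊆ Ω

/-- The classical partial derivative `∂φ/∂x_i`. -/
noncomputable def partialDeriv {d : ℕ} (i : Fin d) (φ : EuclideanSpace ℝ (Fin d) → ℂ)
    (x : EuclideanSpace ℝ (Fin d)) : ℂ :=
  fderiv ℝ φ x (EuclideanSpace.single i 1)

/-- `g` is the weak partial derivative `∂u/∂x_i` of `u` on `Ω`. -/
def HasWeakDeriv {d : ℕ} (Ω : Set (EuclideanSpace ℝ (Fin d))) (i : Fin d) (u g : L2 Ω) : Prop :=
  ∀ φ : EuclideanSpace ℝ (Fin d) → ℂ, IsTestFunction Ω φ →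
    ∫ x in Ω, partialDeriv i φ x * u x = - ∫ x in Ω, φ x * g x

section WeakDerivative

variable {d : ℕ} {Ω : Set (EuclideanSpace ℝ (Fin d))} {i : Fin d}

theorem IsTestFunction.memLp {φ : EuclideanSpace ℝ (Fin d) → ℂ} (h : IsTestFunction Ω φ) :
    MemLp φ 2 (volume.restrict Ω) :=
  (h.smooth.continuous.memLp_of_hasCompactSupport h.compact).restrict Ω

theorem IsTestFunction.partialDeriv_memLp {φ : EuclideanSpace ℝ (Fin d) → ℂ}
    (h : IsTestFunction Ω φ) (i : Fin d) : MemLp (partialDeriv i φ) 2 (volume.restrict Ω) := by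
  have hc : Continuous (partialDeriv i φ) :=
    (h.smooth.continuous_fderiv (by simp)).clm_apply continuous_const
  have hs : HasCompactSupport (partialDeriv i φ) :=
    (h.compact.fderiv (𝕜 := ℝ)).comp_left
      (g := fun T : EuclideanSpace ℝ (Fin d) →L[ℝ] ℂ => T (EuclideanSpace.single i 1)) rfl
  exact (hc.memLp_of_hasCompactSupport hs).restrict Ω

theorem integrable_mul_L2 {φ : EuclideanSpace ℝ (Fin d) → ℂ}
    (h : MemLp φ 2 (volume.restrict Ω)) (u : L2 Ω) :
    Integrable (fun x => φ x * u x) (volume.restrict Ω) :=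
  h.integrable_mul (Lp.memLp u)

theorem HasWeakDeriv.zero : HasWeakDeriv Ω i 0 0 := by
  intro φ _
  have h : ∀ ψ : EuclideanSpace ℝ (Fin d) → ℂ, ∫ x in Ω, ψ x * (0 : L2 Ω) x = 0 := by
    intro ψ
    rw [← integral_zero (EuclideanSpace ℝ (Fin d)) ℂ (μ := volume.restrict Ω)]
    refine integral_congr_ae ?_
    filter_upwards [Lp.coeFn_zero ℂ 2 (volume.restrict Ω)] with x hx
    simp only [hx, Pi.zero_apply, mul_zero]
  rw [h, h, neg_zero]

theorem HasWeakDeriv.add {u g u' g' : L2 Ω} (h : HasWeakDeriv Ω i u g)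
    (h' : HasWeakDeriv Ω i u' g') : HasWeakDeriv Ω i (u + u') (g + g') := by
  intro φ hφ
  have key : ∀ (ψ : EuclideanSpace ℝ (Fin d) → ℂ), MemLp ψ 2 (volume.restrict Ω) →
      ∀ a b : L2 Ω, ∫ x in Ω, ψ x * (a + b) x
        = (∫ x in Ω, ψ x * a x) + ∫ x in Ω, ψ x * b x := by
    intro ψ hψ a b
    rw [← integral_add (integrable_mul_L2 hψ a) (integrable_mul_L2 hψ b)]
    refine integral_congr_ae ?_
    filter_upwards [Lp.coeFn_add a b] with x hx
    simp only [hx, Pi.add_apply, mul_add]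
  rw [key _ (hφ.partialDeriv_memLp i), key _ hφ.memLp, h φ hφ, h' φ hφ]
  ring

theorem HasWeakDeriv.smul {u g : L2 Ω} (c : ℂ) (h : HasWeakDeriv Ω i u g) :
    HasWeakDeriv Ω i (c • u) (c • g) := by
  intro φ hφ
  have key : ∀ (ψ : EuclideanSpace ℝ (Fin d) → ℂ) (a : L2 Ω),
      ∫ x in Ω, ψ x * (c • a) x = c * ∫ x in Ω, ψ x * a x := by
    intro ψ a
    rw [← integral_const_mul]
    refine integral_congr_ae ?_
    filter_upwards [Lp.coeFn_smul c a] with x hx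
    simp only [hx, Pi.smul_apply, smul_eq_mul]
    ring
  rw [key, key, h φ hφ]
  ring

/-- On an open set the weak derivative is unique. -/
theorem HasWeakDeriv.unique (hΩ : IsOpen Ω) {u g g' : L2 Ω} (h : HasWeakDeriv Ω i u g)
    (h' : HasWeakDeriv Ω i u g') : g = g' := by
  rw [← sub_eq_zero]
  have hd := h.add (h'.smul (-1))
  rw [neg_one_smul, neg_one_smul, ← sub_eq_add_neg, ← sub_eq_add_neg, sub_self] at hd
  set w : L2 Ω := g - g'
  have hloc : LocallyIntegrableOn (w : EuclideanSpace ℝ (Fin d) → ℂ) Ω := by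
    refine (locallyIntegrableOn_iff hΩ.isLocallyClosed).2 fun K hK hKc => ?_
    have h2 : MemLp (w : EuclideanSpace ℝ (Fin d) → ℂ) 2 (volume.restrict K) :=
      (Lp.memLp w).mono_measure (Measure.restrict_mono hK le_rfl)
    have : IsFiniteMeasure ((volume : Measure (EuclideanSpace ℝ (Fin d))).restrict K) :=
      ⟨by rw [Measure.restrict_apply_univ]; exact hKc.measure_lt_top⟩
    exact h2.integrable (by norm_num)
  have hae := hΩ.ae_eq_zero_of_integral_contDiff_smul_eq_zero hloc (by
    intro φ hφ hφc hφs
    have ht : IsTestFunction Ω (fun x => (φ x : ℂ)) :=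
      { smooth := Complex.ofRealCLM.contDiff.comp hφ
        compact := hφc.comp_left (g := fun r : ℝ => (r : ℂ)) Complex.ofReal_zero
        support := (closure_mono (fun x hx => by
          simpa [Function.mem_support] using hx)).trans hφs }
    have h0 := hd _ ht
    have hz : ∫ x in Ω, partialDeriv i (fun x => (φ x : ℂ)) x * (0 : L2 Ω) x = 0 := by
      rw [← integral_zero (EuclideanSpace ℝ (Fin d)) ℂ (μ := volume.restrict Ω)]
      refine integral_congr_ae ?_
      filter_upwards [Lp.coeFn_zero ℂ 2 (volume.restrict Ω)] with x hx
      simp only [hx, Pi.zero_apply, mul_zero]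
    rw [hz, eq_comm, neg_eq_zero] at h0
    rw [← h0]
    rw [← setIntegral_eq_integral_of_forall_compl_eq_zero (s := Ω)]
    · simp [Complex.real_smul]
    · intro x hx
      have : φ x = 0 := by
        by_contra hne
        exact hx (hφs (subset_tsupport _ hne))
      simp [this])
  refine Lp.ext ?_
  have h1 : ∀ᵐ x ∂(volume.restrict Ω), w x = 0 :=
    (ae_restrict_iff' hΩ.measurableSet).2 hae
  filter_upwards [h1, Lp.coeFn_zero ℂ 2 (volume.restrict Ω)] with x hx hx0
  rw [hx, hx0]; rfl

open Classical in
/-- The weak partial derivative `∂u/∂x_i ∈ L²(Ω)`, with value `0` if there is none in `L²(Ω)`. -/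
noncomputable def weakDeriv (Ω : Set (EuclideanSpace ℝ (Fin d))) (i : Fin d) (u : L2 Ω) : L2 Ω :=
  if h : ∃ g, HasWeakDeriv Ω i u g then h.choose else 0

theorem HasWeakDeriv.weakDeriv_eq (hΩ : IsOpen Ω) {u g : L2 Ω} (h : HasWeakDeriv Ω i u g) :
    weakDeriv Ω i u = g := by
  have hex : ∃ g, HasWeakDeriv Ω i u g := ⟨g, h⟩
  rw [weakDeriv, dif_pos hex]
  exact hex.choose_spec.unique hΩ h

end WeakDerivative

/-- The Sobolev space `H^k(Ω)`: all weak derivatives up to order `k` are in `L²(Ω)`. -/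
noncomputable def sobolev {d : ℕ} (Ω : Set (EuclideanSpace ℝ (Fin d))) : ℕ → Submodule ℂ (L2 Ω)
  | 0 => ⊤
  | k + 1 =>
    { carrier := {u | ∀ i, ∃ g ∈ sobolev Ω k, HasWeakDeriv Ω i u g}
      zero_mem' := fun _ => ⟨0, Submodule.zero_mem _, HasWeakDeriv.zero⟩
      add_mem' := fun hu hu' i => by
        obtain ⟨g, hg, h⟩ := hu i
        obtain ⟨g', hg', h'⟩ := hu' i
        exact ⟨g + g', Submodule.add_mem _ hg hg', h.add h'⟩
      smul_mem' := fun c _ hu i => by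
        obtain ⟨g, hg, h⟩ := hu i
        exact ⟨c • g, Submodule.smul_mem _ c hg, h.smul c⟩ }

/-- `u ∈ H^1_0(Ω)`: `u` is a limit in `H^1(Ω)` of functions in `C_c^∞(Ω)`. -/
def MemH10 {d : ℕ} (Ω : Set (EuclideanSpace ℝ (Fin d))) (u : L2 Ω) : Prop :=
  u ∈ sobolev Ω 1 ∧
    ∃ φ : ℕ → EuclideanSpace ℝ (Fin d) → ℂ, (∀ n, IsTestFunction Ω (φ n)) ∧
      Tendsto (fun n => eLpNorm (fun x => u x - φ n x) 2 (volume.restrict Ω)) atTop (𝓝 0) ∧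
      ∀ i, Tendsto (fun n => eLpNorm (fun x => weakDeriv Ω i u x - partialDeriv i (φ n) x) 2
        (volume.restrict Ω)) atTop (𝓝 0)

section Operator

variable {d : ℕ} {Ω : Set (EuclideanSpace ℝ (Fin d))}

theorem exists_hasWeakDeriv {k : ℕ} {u : L2 Ω} (hu : u ∈ sobolev Ω (k + 1)) (i : Fin d) :
    ∃ g ∈ sobolev Ω k, HasWeakDeriv Ω i u g := hu i

theorem sobolev_two_le_one : sobolev Ω 2 ≤ sobolev Ω 1 := fun _ hu i => by
  obtain ⟨g, _, h⟩ := exists_hasWeakDeriv hu i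
  exact ⟨g, trivial, h⟩

theorem weakDeriv_mem (hΩ : IsOpen Ω) {k : ℕ} {u : L2 Ω} (hu : u ∈ sobolev Ω (k + 1))
    (i : Fin d) : weakDeriv Ω i u ∈ sobolev Ω k := by
  obtain ⟨g, hg, h⟩ := exists_hasWeakDeriv hu i
  rwa [h.weakDeriv_eq hΩ]

theorem weakDeriv_add (hΩ : IsOpen Ω) {k : ℕ} {u u' : L2 Ω} (hu : u ∈ sobolev Ω (k + 1))
    (hu' : u' ∈ sobolev Ω (k + 1)) (i : Fin d) :
    weakDeriv Ω i (u + u') = weakDeriv Ω i u + weakDeriv Ω i u' := by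
  obtain ⟨g, _, h⟩ := exists_hasWeakDeriv hu i
  obtain ⟨g', _, h'⟩ := exists_hasWeakDeriv hu' i
  rw [h.weakDeriv_eq hΩ, h'.weakDeriv_eq hΩ, (h.add h').weakDeriv_eq hΩ]

theorem weakDeriv_smul (hΩ : IsOpen Ω) {k : ℕ} {u : L2 Ω} (hu : u ∈ sobolev Ω (k + 1))
    (c : ℂ) (i : Fin d) : weakDeriv Ω i (c • u) = c • weakDeriv Ω i u := by
  obtain ⟨g, _, h⟩ := exists_hasWeakDeriv hu i
  rw [h.weakDeriv_eq hΩ, (h.smul c).weakDeriv_eq hΩ]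

/-- The space `H^1_0(Ω)`, for open `Ω`. -/
noncomputable def sobolevZero (Ω : Set (EuclideanSpace ℝ (Fin d))) (hΩ : IsOpen Ω) : Submodule ℂ (L2 Ω) where
  carrier := {u | MemH10 Ω u}
  zero_mem' := by
    refine ⟨Submodule.zero_mem _, fun _ _ => 0, fun _ => ⟨contDiff_const, ?_, ?_⟩, ?_, ?_⟩
    · exact HasCompactSupport.zero
    · rw [show (fun _ : EuclideanSpace ℝ (Fin d) => (0 : ℂ)) = 0 from rfl, tsupport_zero]
      exact Set.empty_subset _
    · have h : eLpNorm (fun x => (0 : L2 Ω) x - 0) 2 (volume.restrict Ω) = 0 := by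
        rw [← eLpNorm_zero (μ := (volume : Measure (EuclideanSpace ℝ (Fin d))).restrict Ω)
          (p := 2) (ε := ℂ)]
        refine eLpNorm_congr_ae ?_
        filter_upwards [Lp.coeFn_zero ℂ 2 (volume.restrict Ω)] with x hx
        simp only [hx, Pi.zero_apply, sub_zero]
      simp only [h]
      exact tendsto_const_nhds
    · intro i
      have h : eLpNorm (fun x => weakDeriv Ω i 0 x - partialDeriv i (fun _ => 0) x) 2
          (volume.restrict Ω) = 0 := by
        rw [HasWeakDeriv.zero.weakDeriv_eq hΩ,
          ← eLpNorm_zero (μ := (volume : Measure (EuclideanSpace ℝ (Fin d))).restrict Ω)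
          (p := 2) (ε := ℂ)]
        refine eLpNorm_congr_ae ?_
        filter_upwards [Lp.coeFn_zero ℂ 2 (volume.restrict Ω)] with x hx
        rw [hx]
        simp [partialDeriv]
      simp only [h]
      exact tendsto_const_nhds
  add_mem' := by
    rintro u u' ⟨hu, φ, hφ, h0, h1⟩ ⟨hu', φ', hφ', h0', h1'⟩
    have key : ∀ (a a' : L2 Ω) (ψ ψ' : ℕ → EuclideanSpace ℝ (Fin d) → ℂ),
        (∀ n, MemLp (ψ n) 2 (volume.restrict Ω)) → (∀ n, MemLp (ψ' n) 2 (volume.restrict Ω)) →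
        Tendsto (fun n => eLpNorm (fun x => a x - ψ n x) 2 (volume.restrict Ω)) atTop (𝓝 0) →
        Tendsto (fun n => eLpNorm (fun x => a' x - ψ' n x) 2 (volume.restrict Ω)) atTop (𝓝 0) →
        Tendsto (fun n => eLpNorm (fun x => (a + a') x - (ψ n x + ψ' n x)) 2
          (volume.restrict Ω)) atTop (𝓝 0) := by
      intro a a' ψ ψ' hm hm' ht ht'
      refine tendsto_of_tendsto_of_tendsto_of_le_of_le tendsto_const_nhds
        (by simpa using ht.add ht') (fun _ => zero_le) fun n => ?_
      refine le_trans (le_of_eq ?_) (eLpNorm_add_le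
        ((Lp.memLp a).sub (hm n)).aestronglyMeasurable
        ((Lp.memLp a').sub (hm' n)).aestronglyMeasurable (by norm_num))
      refine eLpNorm_congr_ae ?_
      filter_upwards [Lp.coeFn_add a a'] with x hx
      simp only [hx, Pi.add_apply]
      ring
    refine ⟨Submodule.add_mem _ hu hu', fun n x => φ n x + φ' n x, fun n => ⟨?_, ?_, ?_⟩,
      key u u' φ φ' (fun n => (hφ n).memLp) (fun n => (hφ' n).memLp) h0 h0', fun i => ?_⟩
    · exact (hφ n).smooth.add (hφ' n).smooth
    · exact (hφ n).compact.add (hφ' n).compact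
    · exact (tsupport_add (φ n) (φ' n)).trans
        (Set.union_subset (hφ n).support (hφ' n).support)
    · have hp : ∀ n x, partialDeriv i (fun x => φ n x + φ' n x) x
          = partialDeriv i (φ n) x + partialDeriv i (φ' n) x := by
        intro n x
        have e := fderiv_fun_add (𝕜 := ℝ) (x := x)
          ((hφ n).smooth.differentiable (by simp)).differentiableAt
          ((hφ' n).smooth.differentiable (by simp)).differentiableAt
        simp only [partialDeriv, e]
        rfl
      simp only [hp, weakDeriv_add hΩ hu hu']
      exact key _ _ _ _ (fun n => (hφ n).partialDeriv_memLp i)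
        (fun n => (hφ' n).partialDeriv_memLp i) (h1 i) (h1' i)
  smul_mem' := by
    rintro c u ⟨hu, φ, hφ, h0, h1⟩
    have key : ∀ (a : L2 Ω) (ψ : ℕ → EuclideanSpace ℝ (Fin d) → ℂ),
        Tendsto (fun n => eLpNorm (fun x => a x - ψ n x) 2 (volume.restrict Ω)) atTop (𝓝 0) →
        Tendsto (fun n => eLpNorm (fun x => (c • a) x - c * ψ n x) 2
          (volume.restrict Ω)) atTop (𝓝 0) := by
      intro a ψ ht
      have e : ∀ n, eLpNorm (fun x => (c • a) x - c * ψ n x) 2 (volume.restrict Ω)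
          = ‖c‖ₑ * eLpNorm (fun x => a x - ψ n x) 2 (volume.restrict Ω) := by
        intro n
        rw [← eLpNorm_const_smul]
        refine eLpNorm_congr_ae ?_
        filter_upwards [Lp.coeFn_smul c a] with x hx
        simp [hx, mul_sub]
      simp only [e]
      simpa using ENNReal.Tendsto.const_mul ht (Or.inr (enorm_ne_top (x := c)))
    refine ⟨Submodule.smul_mem _ c hu, fun n x => c * φ n x, fun n => ⟨?_, ?_, ?_⟩,
      key u φ h0, fun i => ?_⟩
    · exact contDiff_const.mul (hφ n).smooth
    · exact (hφ n).compact.mul_left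
    · exact (tsupport_mul_subset_right (f := fun _ => c) (g := φ n)).trans (hφ n).support
    · have hp : ∀ n x, partialDeriv i (fun x => c * φ n x) x = c * partialDeriv i (φ n) x := by
        intro n x
        have e := fderiv_const_mul (𝕜 := ℝ) (x := x)
          ((hφ n).smooth.differentiable (by simp)).differentiableAt c
        simp only [partialDeriv, e]
        rfl
      simp only [hp, weakDeriv_smul hΩ hu]
      exact key _ _ (h1 i)

/-- The Laplacian `Δu = ∑_i ∂²u/∂x_i²`, in the weak sense, on `H^2(Ω)`. -/
noncomputable def laplacian (Ω : Set (EuclideanSpace ℝ (Fin d))) (hΩ : IsOpen Ω) :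
    sobolev Ω 2 →ₗ[ℂ] L2 Ω where
  toFun u := ∑ i, weakDeriv Ω i (weakDeriv Ω i u)
  map_add' u u' := by
    rw [← Finset.sum_add_distrib]
    refine Finset.sum_congr rfl fun i _ => ?_
    rw [Submodule.coe_add, weakDeriv_add hΩ u.2 u'.2,
      weakDeriv_add hΩ (weakDeriv_mem hΩ u.2 i) (weakDeriv_mem hΩ u'.2 i)]
  map_smul' c u := by
    rw [RingHom.id_apply, Finset.smul_sum]
    refine Finset.sum_congr rfl fun i _ => ?_
    rw [Submodule.coe_smul, weakDeriv_smul hΩ u.2, weakDeriv_smul hΩ (weakDeriv_mem hΩ u.2 i)]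

theorem potential_mul_memLp {v : EuclideanSpace ℝ (Fin d) → ℝ} (hv : MemLp v ∞ volume)
    (u : L2 Ω) : MemLp (fun x => (v x : ℂ) * u x) 2 (volume.restrict Ω) := by
  have h : MemLp (fun x => (v x : ℂ)) ∞ (volume.restrict Ω) := (hv.restrict Ω).ofReal
  exact (Lp.memLp u).mul h

/-- Multiplication by a bounded potential `v` on `L²(Ω)`. -/
noncomputable def mulPotential (Ω : Set (EuclideanSpace ℝ (Fin d)))
    (v : EuclideanSpace ℝ (Fin d) → ℝ) (hv : MemLp v ∞ volume) : L2 Ω →ₗ[ℂ] L2 Ω where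
  toFun u := (potential_mul_memLp hv u).toLp
  map_add' u u' := by
    rw [← MemLp.toLp_add]
    refine MemLp.toLp_congr _ _ ?_
    filter_upwards [Lp.coeFn_add u u'] with x hx
    simp only [hx, Pi.add_apply, mul_add]
  map_smul' c u := by
    rw [RingHom.id_apply, ← MemLp.toLp_const_smul]
    refine MemLp.toLp_congr _ _ ?_
    filter_upwards [Lp.coeFn_smul c u] with x hx
    simp only [hx, Pi.smul_apply, smul_eq_mul]
    ring

/-- The Schrödinger operator `h_L = -Δ + v` with Dirichlet boundary conditions in
`L²((-L/2, L/2)^d)`, as an unbounded operator with domain `H^1_0 ∩ H^2`. -/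
noncomputable def schrodinger (d : ℕ) (L : ℝ) (v : EuclideanSpace ℝ (Fin d) → ℝ)
    (hv : MemLp v ∞ volume) : L2 (cube d L) →ₗ.[ℂ] L2 (cube d L) where
  domain := sobolevZero (cube d L) (isOpen_cube d L) ⊓ sobolev (cube d L) 2
  toFun := -(laplacian (cube d L) (isOpen_cube d L)).comp (Submodule.inclusion inf_le_right)
    + (mulPotential (cube d L) v hv).comp (Submodule.subtype _)

end Operator

section Eigenvalues

variable {H : Type*} [AddCommGroup H] [Module ℂ H]

/-- The eigenspace `{u ∈ dom A | A u = t u}` of an unbounded operator for a real number `t`. -/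
def eigenspace (A : H →ₗ.[ℂ] H) (t : ℝ) : Submodule ℂ H :=
  (LinearMap.ker (A.toFun - (t : ℂ) • A.domain.subtype)).map A.domain.subtype

theorem mem_eigenspace {A : H →ₗ.[ℂ] H} {t : ℝ} {u : H} :
    u ∈ eigenspace A t ↔ ∃ hu : u ∈ A.domain, A ⟨u, hu⟩ = (t : ℂ) • u := by
  simp only [eigenspace, Submodule.mem_map, LinearMap.mem_ker, LinearMap.sub_apply, sub_eq_zero]
  constructor
  · rintro ⟨w, hw, rfl⟩
    exact ⟨w.2, hw⟩
  · rintro ⟨hu, h⟩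
    exact ⟨⟨u, hu⟩, h, rfl⟩

/-- `lam` is the `k`-th eigenvalue `λ_k` of `A`, where the (real) eigenvalues
`λ_0 ≤ λ_1 ≤ …` are listed in nondecreasing order and counted with multiplicity: `lam` is the
least `t` for which the eigenvectors with eigenvalue at most `t` span at least `k + 1`
dimensions. Such a `lam` is unique, and it is an eigenvalue of `A`. -/
def IsNthEigenvalue (A : H →ₗ.[ℂ] H) (k : ℕ) (lam : ℝ) : Prop :=
  IsLeast {t : ℝ | ((k + 1 : ℕ) : Cardinal) ≤
    Module.rank ℂ (⨆ s : Set.Iic t, eigenspace A (s : ℝ) : Submodule ℂ H)} lam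

end Eigenvalues

end SpectralGap

/-! On the cube the Dirichlet Laplacian is diagonal in products of sines, with eigenvalues `∑ j, ((k
j + 1) * π / L) ^ 2`. Its two lowest levels `d * π² / L²` and `(d + 3) * π² / L²` differ by `3 * π²
/ L²`, and the potential is too weak to close this gap. Since `v ≥ 0`, adding it only raises
eigenvalues, so `λ₁ ≥ (d + 3) * π² / L²` and `λ₀ ≥ 0`. Conversely, normalized sine products are
bounded by `(2 / L) ^ (d / 2)`, so on the span of `n` of them the potential energy of a unit vector
is at most `n * (2 / L) ^ d * ‖v‖₁`. For `d ≥ 3` and `L ≥ max 1 (2 ^ d * ‖v‖₁)` this is at most `n /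
L²`. Min-max with `n = 1, 2` gives `λ₀ ≤ (d * π² + 1) / L²` and `λ₁ ≤ ((d + 3) * π² + 2) / L²`, and
both gap bounds follow.

The spectral theory is done abstractly for `IsDiagonalAdd`. A compact symmetric resolvent makes the
eigenvectors complete. `IsDiagonalAdd.rank_lowSpace_le` bounds the number of low eigenvalues from
above, hence eigenvalues from below; `IsDiagonalAdd.finrank_le_rank_lowSpace` does the reverse, and
`IsDiagonalAdd.exists_isNthEigenvalue` turns it into actual eigenvalues.

The analysis shows that the operator on `H^1_0 ∩ H^2` fits this frame: sine products are complete
(`eq_zero_of_forall_integral_modeFn`), two integrations by parts diagonalize the Laplacian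
(`inner_mode_weakDeriv_weakDeriv`), and termwise differentiation of sine series gives elliptic
regularity (`mem_domain_of_coeff`). -/

namespace SpectralGap

/-! ### Diagonal operators in a Hilbert basis -/

section Diagonal

variable {ι H : Type*} [NormedAddCommGroup H] [InnerProductSpace ℂ H]

theorem HilbertBasis.ext_inner (b : HilbertBasis ι ℂ H) {x y : H}
    (h : ∀ n, inner ℂ (b n) x = inner ℂ (b n) y) : x = y := by
  apply b.repr.injective
  ext n
  simpa only [b.repr_apply_apply] using h n

theorem HilbertBasis.hasSum_norm_sq (b : HilbertBasis ι ℂ H) (x : H) :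
    HasSum (fun n => ‖inner ℂ (b n) x‖ ^ 2) (‖x‖ ^ 2) := by
  have h := (b.hasSum_inner_mul_inner x x).mapL Complex.reCLM
  have e : ∀ n, Complex.reCLM (inner ℂ x (b n) * inner ℂ (b n) x) = ‖inner ℂ (b n) x‖ ^ 2 := by
    intro n
    rw [← inner_conj_symm x (b n), Complex.reCLM_apply, ← Complex.normSq_eq_conj_mul_self,
      Complex.ofReal_re, Complex.normSq_eq_norm_sq]
  simp only [e] at h
  convert h using 1
  rw [Complex.reCLM_apply, ← inner_self_eq_norm_sq (𝕜 := ℂ)]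
  rfl

/-- Bounded diagonal operators with respect to a Hilbert basis. -/
theorem exists_diagonal (b : HilbertBasis ι ℂ H) (a : ι → ℝ) {C : ℝ} (hC : 0 ≤ C)
    (ha : ∀ n, |a n| ≤ C) :
    ∃ S : H →L[ℂ] H, (∀ n f, inner ℂ (b n) (S f) = a n * inner ℂ (b n) f) ∧ ‖S‖ ≤ C := by
  have hmem : ∀ f : lp (fun _ : ι => ℂ) 2, Memℓp (fun n => (a n : ℂ) * f n) 2 := by
    intro f
    refine ((lp.memℓp f).const_mul (C : ℂ)).mono' ?_
    intro n
    simp only [norm_mul, Complex.norm_real, Real.norm_eq_abs]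
    exact mul_le_mul_of_nonneg_right ((ha n).trans (le_abs_self C)) (norm_nonneg _)
  let T : lp (fun _ : ι => ℂ) 2 →ₗ[ℂ] lp (fun _ : ι => ℂ) 2 :=
    { toFun := fun f => ⟨fun n => (a n : ℂ) * f n, hmem f⟩
      map_add' := fun f g => by
        ext n
        exact mul_add _ _ _
      map_smul' := fun c f => by
        ext n
        simp [mul_left_comm] }
  let U : H →ₗ[ℂ] H := b.repr.symm.toLinearMap ∘ₗ T ∘ₗ b.repr.toLinearMap
  have hU : ∀ n f, inner ℂ (b n) (U f) = a n * inner ℂ (b n) f := by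
    intro n f
    rw [← b.repr_apply_apply, ← b.repr_apply_apply]
    simp [U, T]
  have hb : ∀ f, ‖U f‖ ≤ C * ‖f‖ := by
    intro f
    refine (sq_le_sq₀ (norm_nonneg _) (by positivity)).1 ?_
    rw [mul_pow]
    refine hasSum_le (fun n => ?_) (HilbertBasis.hasSum_norm_sq b (U f))
      ((HilbertBasis.hasSum_norm_sq b f).mul_left (C ^ 2))
    rw [hU, norm_mul, mul_pow, Complex.norm_real, Real.norm_eq_abs]
    gcongr
    exact ha n
  exact ⟨U.mkContinuous C hb, hU, LinearMap.mkContinuous_norm_le _ hC _⟩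

/-- Keeping only the finitely many weights with `|a n| > 1 / (k + 1)` gives finite-rank operators
within `1 / (k + 1)` of `S` in norm. -/
theorem isCompactOperator_of_diagonal [CompleteSpace H] (b : HilbertBasis ι ℂ H) {a : ι → ℝ}
    (ha : ∀ ε > 0, {n | ε < |a n|}.Finite) {S : H →L[ℂ] H}
    (hS : ∀ n f, inner ℂ (b n) (S f) = a n * inner ℂ (b n) f) : IsCompactOperator S := by
  classical
  let G : ℕ → H →L[ℂ] H := fun k =>
    ∑ n ∈ (ha (1 / ((k : ℝ) + 1)) (by positivity)).toFinset,
      (a n : ℂ) • (innerSL ℂ (b n)).smulRight (b n)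
  have hG : ∀ k n f, inner ℂ (b n) ((S - G k) f)
      = ((if 1 / ((k : ℝ) + 1) < |a n| then 0 else a n : ℝ) : ℂ) * inner ℂ (b n) f := by
    intro k n f
    have hon := orthonormal_iff_ite.1 b.orthonormal
    simp only [sub_apply, inner_sub_right, hS, G,
      sum_apply, inner_sum, smul_apply,
      ContinuousLinearMap.smulRight_apply, innerSL_apply_apply, inner_smul_right, hon]
    simp only [mul_ite, mul_one, mul_zero, Finset.sum_ite_eq, Set.Finite.mem_toFinset,
      Set.mem_ofPred_eq]
    split_ifs <;> simp
  refine isCompactOperator_of_tendsto (F := G) (l := atTop) ?_ (Eventually.of_forall fun k => ?_)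
  · rw [tendsto_iff_norm_sub_tendsto_zero]
    refine squeeze_zero (fun _ => norm_nonneg _) (fun k => ?_)
      tendsto_one_div_add_atTop_nhds_zero_nat
    rw [norm_sub_rev]
    refine ContinuousLinearMap.opNorm_le_bound _ (by positivity) fun f => ?_
    refine (sq_le_sq₀ (norm_nonneg _) (by positivity)).1 ?_
    rw [mul_pow]
    refine hasSum_le (fun n => ?_) (HilbertBasis.hasSum_norm_sq b _)
      ((HilbertBasis.hasSum_norm_sq b f).mul_left _)
    rw [hG, norm_mul, mul_pow, Complex.norm_real, Real.norm_eq_abs]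
    gcongr
    split_ifs with h
    · simp only [abs_zero]; positivity
    · exact not_lt.1 h
  · have : ∀ s : Finset ι, IsCompactOperator
        (∑ n ∈ s, (a n : ℂ) • (innerSL ℂ (b n)).smulRight (b n) : H →L[ℂ] H) := by
      intro s
      refine Submodule.sum_mem (compactOperator (RingHom.id ℂ) H H) fun n _ => ?_
      refine Submodule.smul_mem _ _ ?_
      exact (isCompactOperator_of_locallyCompactSpace_rng
        (ContinuousLinearMap.toSpanSingleton ℂ (b n))).comp_clm (innerSL ℂ (b n))
    exact this _

theorem HilbertBasis.hasSum_re_inner (b : HilbertBasis ι ℂ H) {μ : ι → ℝ} {u w : H}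
    (hw : ∀ n, inner ℂ (b n) w = μ n * inner ℂ (b n) u) :
    HasSum (fun n => μ n * ‖inner ℂ (b n) u‖ ^ 2) (inner ℂ u w).re := by
  have h1 := (b.hasSum_inner_mul_inner u w).mapL Complex.reCLM
  have e : ∀ n, Complex.reCLM (inner ℂ u (b n) * inner ℂ (b n) w)
      = μ n * ‖inner ℂ (b n) u‖ ^ 2 := by
    intro n
    rw [hw, ← inner_conj_symm u (b n), Complex.reCLM_apply, mul_left_comm,
      ← Complex.normSq_eq_conj_mul_self, ← Complex.ofReal_mul,
      Complex.ofReal_re, Complex.normSq_eq_norm_sq]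
  simp only [e] at h1
  exact h1

/-- A vector without components on the basis elements with weight at most `t` has quadratic
form above `t`. -/
theorem lt_re_inner_of_diagonal (b : HilbertBasis ι ℂ H) {μ : ι → ℝ} {u w : H} {t : ℝ}
    (hw : ∀ n, inner ℂ (b n) w = μ n * inner ℂ (b n) u)
    (h0 : ∀ n, μ n ≤ t → inner ℂ (b n) u = 0) (hu : u ≠ 0) :
    t * ‖u‖ ^ 2 < (inner ℂ u w).re := by
  have h1 := HilbertBasis.hasSum_re_inner b hw
  have h2 := (HilbertBasis.hasSum_norm_sq b u).mul_left t
  obtain ⟨n, hn⟩ : ∃ n, inner ℂ (b n) u ≠ 0 := by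
    by_contra! h
    exact hu (HilbertBasis.ext_inner b fun n => by rw [h n, inner_zero_right])
  -- Strictness comes from one nonzero coefficient, whose weight must exceed `t`.
  refine hasSum_lt (i := n) (fun m => ?_) ?_ h2 h1
  · rcases le_or_gt (μ m) t with hm | hm
    · simp [h0 m hm]
    · gcongr
  · have : t < μ n := not_le.1 fun h => hn (h0 n h)
    gcongr

end Diagonal

/-! ### Spectral theory of a diagonal operator plus a bounded nonnegative one -/

section Operator

variable {ι H : Type*} [NormedAddCommGroup H] [InnerProductSpace ℂ H]

/-- `A` is the sum of the self-adjoint operator with eigenbasis `b` and eigenvalues `μ → ∞`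
and of the bounded nonnegative operator `V`. -/
structure IsDiagonalAdd (A : H →ₗ.[ℂ] H) (b : HilbertBasis ι ℂ H) (μ : ι → ℝ)
    (V : H →L[ℂ] H) : Prop where
  pos : ∀ n, 0 < μ n
  finite : ∀ t, {n | μ n ≤ t}.Finite
  inner_apply : ∀ (u : A.domain) n,
    inner ℂ (b n) (A u) = μ n * inner ℂ (b n) (u : H) + inner ℂ (b n) (V u)
  -- Maximality of the domain: this makes the diagonal part self-adjoint rather than merely
  -- symmetric. For the Laplacian it is elliptic regularity.
  mem_domain : ∀ u f : H, (∀ n, (μ n : ℂ) * inner ℂ (b n) u = inner ℂ (b n) f) → u ∈ A.domain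
  symm : ∀ x y : H, inner ℂ (V x) y = inner ℂ x (V y)
  nonneg : ∀ x : H, 0 ≤ (inner ℂ x (V x)).re

variable {A : H →ₗ.[ℂ] H} {b : HilbertBasis ι ℂ H} {μ : ι → ℝ} {V : H →L[ℂ] H}

theorem IsDiagonalAdd.symmetric (h : IsDiagonalAdd A b μ V) (u w : A.domain) :
    inner ℂ (A u) (w : H) = inner ℂ (u : H) (A w) := by
  have key : inner ℂ (A u - V u) (w : H) = inner ℂ (u : H) (A w - V w) := by
    have h1 := b.hasSum_inner_mul_inner (A u - V u) (w : H)
    have h2 := b.hasSum_inner_mul_inner (u : H) (A w - V w)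
    have e : (fun n => inner ℂ (A u - V u) (b n) * inner ℂ (b n) (w : H))
        = fun n => inner ℂ (u : H) (b n) * inner ℂ (b n) (A w - V w) := by
      funext n
      rw [← inner_conj_symm _ (b n), inner_sub_right, inner_sub_right, h.inner_apply,
        h.inner_apply, add_sub_cancel_right, add_sub_cancel_right, map_mul, inner_conj_symm,
        Complex.conj_ofReal]
      ring
    rw [e] at h1
    exact h1.unique h2
  rw [inner_sub_left, inner_sub_right, h.symm] at key
  exact sub_left_inj.1 key

/-- The diagonal part already exceeds `t`, and the nonnegative `V` can only increase the form. -/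
theorem IsDiagonalAdd.lt_re_inner (h : IsDiagonalAdd A b μ V) {u : A.domain} {t : ℝ}
    (h0 : ∀ n, μ n ≤ t → inner ℂ (b n) (u : H) = 0) (hu : (u : H) ≠ 0) :
    t * ‖(u : H)‖ ^ 2 < (inner ℂ (u : H) (A u)).re := by
  have h1 := lt_re_inner_of_diagonal (u := (u : H)) (w := A u - V u) b (μ := μ) (t := t)
    (fun n => by rw [inner_sub_right, h.inner_apply, add_sub_cancel_right]) h0 hu
  rw [inner_sub_right, Complex.sub_re] at h1
  linarith [h.nonneg u]

/-- The resolvent of a diagonal operator with a bounded perturbation. -/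
theorem IsDiagonalAdd.exists_resolvent [CompleteSpace H] (h : IsDiagonalAdd A b μ V) :
    ∃ (c : ℝ) (R : H →L[ℂ] H), IsCompactOperator R ∧ (R : H →ₗ[ℂ] H).IsSymmetric ∧
      ∀ f, ∃ hf : R f ∈ A.domain, A ⟨R f, hf⟩ + (c : ℂ) • R f = f := by
  -- The shift makes the inverse `S` of the shifted diagonal part satisfy `‖S‖ * ‖V‖ < 1`. Hence `1
  -- + S V` is invertible by a Neumann series, and `(1 + S V)⁻¹ S` is the resolvent.
  set c : ℝ := ‖V‖ + 1 with hc
  have hc0 : 0 < c := by positivity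
  have hμc : ∀ n, 0 < μ n + c := fun n => add_pos (h.pos n) hc0
  obtain ⟨S, hS, hSn⟩ := exists_diagonal b (fun n => 1 / (μ n + c)) (C := 1 / c) (by positivity)
    (fun n => by
      rw [abs_of_pos (one_div_pos.2 (hμc n))]
      exact one_div_le_one_div_of_le hc0 (by linarith [h.pos n]))
  have hScpt : IsCompactOperator S := by
    refine isCompactOperator_of_diagonal b (fun ε hε => ?_) hS
    refine (h.finite (1 / ε)).subset fun n hn => ?_
    simp only [Set.mem_ofPred_eq] at hn ⊢
    rw [abs_of_pos (one_div_pos.2 (hμc n)), lt_one_div hε (hμc n)] at hn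
    linarith
  have hunit : IsUnit (1 - (-(S * V))) := by
    refine isUnit_one_sub_of_norm_lt_one ?_
    rw [norm_neg]
    calc ‖S * V‖ ≤ ‖S‖ * ‖V‖ := norm_mul_le _ _
      _ ≤ 1 / c * ‖V‖ := by gcongr
      _ < 1 := by rw [one_div, inv_mul_lt_one₀ hc0]; linarith
  obtain ⟨U, hU⟩ := hunit
  set R : H →L[ℂ] H := (↑U⁻¹ : H →L[ℂ] H) * S with hR
  -- The resolvent equation with `V` moved to the right-hand side; it yields both the coordinates
  -- and the symmetry of `R`.
  have hRS : ∀ f, R f = S (f - V (R f)) := by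
    intro f
    have h1 : (U : H →L[ℂ] H) * R = S := by rw [hR, Units.mul_inv_cancel_left]
    have h2 := congrArg (fun T : H →L[ℂ] H => T f) h1
    rw [hU, sub_neg_eq_add] at h2
    have h3 : R f + S (V (R f)) = S f := h2
    rw [map_sub, ← h3, add_sub_cancel_right]
  have hcoord : ∀ f n, (μ n : ℂ) * inner ℂ (b n) (R f)
      = inner ℂ (b n) (f - V (R f) - (c : ℂ) • R f) := by
    intro f n
    have h1 : ((μ n + c : ℝ) : ℂ) * inner ℂ (b n) (R f) = inner ℂ (b n) (f - V (R f)) := by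
      rw [hRS f, hS, ← hRS f, ← mul_assoc, ← Complex.ofReal_mul, mul_one_div_cancel (hμc n).ne',
        Complex.ofReal_one, one_mul]
    rw [inner_sub_right, ← h1, inner_smul_right]
    push_cast
    ring
  have hSsymm : ∀ x y, inner ℂ (S x) y = inner ℂ x (S y) := by
    intro x y
    have h1 := b.hasSum_inner_mul_inner (S x) y
    have h2 := b.hasSum_inner_mul_inner x (S y)
    have e : (fun n => inner ℂ (S x) (b n) * inner ℂ (b n) y)
        = fun n => inner ℂ x (b n) * inner ℂ (b n) (S y) := by
      funext n
      rw [← inner_conj_symm _ (b n), hS, hS, map_mul, inner_conj_symm, Complex.conj_ofReal]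
      ring
    rw [e] at h1
    exact h1.unique h2
  refine ⟨c, R, hScpt.clm_comp _, ?_, fun f => ?_⟩
  · intro f g
    change inner ℂ (R f) g = inner ℂ f (R g)
    -- Both sides pair `f - V (R f)` with `g - V (R g)` through the symmetric `S`; the terms
    -- containing `V` then cancel.
    have e1 : inner ℂ (R f) (g - V (R g)) = inner ℂ (f - V (R f)) (R g) := by
      conv_lhs => rw [hRS f]
      conv_rhs => rw [hRS g]
      exact hSsymm _ _
    rw [inner_sub_left, inner_sub_right, h.symm] at e1
    exact sub_left_inj.1 e1
  · refine ⟨h.mem_domain _ _ (hcoord f), ?_⟩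
    refine HilbertBasis.ext_inner b fun n => ?_
    rw [inner_add_right, h.inner_apply]
    change (μ n : ℂ) * inner ℂ (b n) (R f) + inner ℂ (b n) (V (R f)) + _ = _
    rw [hcoord, inner_sub_right, inner_sub_right]
    ring

/-- The spectral theorem for the compact symmetric `R` gives completeness of its eigenvectors, and
an eigenvector of `R` for `ρ` is one of `A` for `ρ⁻¹ - c`. -/
theorem IsDiagonalAdd.orthogonal_iSup_eigenspace [CompleteSpace H] (h : IsDiagonalAdd A b μ V) :
    (⨆ s : ℝ, eigenspace A s)ᗮ = ⊥ := by
  obtain ⟨c, R, hRc, hRs, hR⟩ := h.exists_resolvent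
  rw [eq_bot_iff, ← ContinuousLinearMap.orthogonalComplement_iSup_eigenspaces_eq_bot hRc hRs]
  refine Submodule.orthogonal_le (iSup_le fun ρ => ?_)
  intro f hf
  by_cases hf0 : f = 0
  · rw [hf0]; exact Submodule.zero_mem _
  have hRf : R f = ρ • f := Module.End.mem_eigenspace_iff.1 hf
  have hev : Module.End.HasEigenvalue (R : H →ₗ[ℂ] H) ρ :=
    Module.End.hasEigenvalue_of_hasEigenvector ⟨hf, hf0⟩
  have hreal := hRs.conj_eigenvalue_eq_self hev
  obtain ⟨hd, hA⟩ := hR f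
  -- `R` is injective, because `A + c` recovers `f` from `R f`.
  have hρ : ρ ≠ 0 := by
    rintro rfl
    have hz : (⟨R f, hd⟩ : A.domain) = 0 := by
      ext
      simp [hRf]
    rw [hz, hRf] at hA
    simp at hA
    exact hf0 hA.symm
  have hfd : f ∈ A.domain := by
    have := A.domain.smul_mem ρ⁻¹ hd
    rwa [hRf, inv_smul_smul₀ hρ] at this
  obtain ⟨r, hr⟩ := Complex.conj_eq_iff_real.1 hreal
  have hz : (⟨R f, hd⟩ : A.domain) = ρ • ⟨f, hfd⟩ := by
    ext
    simp [hRf]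
  rw [hz, LinearPMap.map_smul, hRf] at hA
  refine Submodule.mem_iSup_of_mem (r⁻¹ - c) (mem_eigenspace.2 ⟨hfd, ?_⟩)
  have hA2 : ρ • A ⟨f, hfd⟩ = f - (c : ℂ) • ρ • f := eq_sub_of_add_eq hA
  calc A ⟨f, hfd⟩ = ρ⁻¹ • (ρ • A ⟨f, hfd⟩) := (inv_smul_smul₀ hρ _).symm
    _ = _ := by
      rw [hA2, smul_sub, smul_comm (c : ℂ) ρ f, inv_smul_smul₀ hρ, hr]
      push_cast
      rw [sub_smul]

/-- The span of the eigenvectors with eigenvalue at most `t`. -/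
def lowSpace {H : Type*} [AddCommGroup H] [Module ℂ H] (A : H →ₗ.[ℂ] H) (t : ℝ) :
    Submodule ℂ H :=
  ⨆ s : Set.Iic t, eigenspace A (s : ℝ)

theorem eigenspace_le_lowSpace {s t : ℝ} (hst : s ≤ t) : eigenspace A s ≤ lowSpace A t :=
  le_iSup (fun s : Set.Iic t => eigenspace A (s : ℝ)) ⟨s, hst⟩

theorem eigenspace_le_domain (t : ℝ) : eigenspace A t ≤ A.domain := by
  intro u hu
  exact (mem_eigenspace.1 hu).1

theorem IsDiagonalAdd.orthogonalFamily (h : IsDiagonalAdd A b μ V) :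
    OrthogonalFamily ℂ (fun s : ℝ => eigenspace A s) fun s => (eigenspace A s).subtypeₗᵢ := by
  intro s t hst x y
  obtain ⟨hx, hx'⟩ := mem_eigenspace.1 x.2
  obtain ⟨hy, hy'⟩ := mem_eigenspace.1 y.2
  have e := h.symmetric ⟨x, hx⟩ ⟨y, hy⟩
  rw [hx', hy', inner_smul_left, inner_smul_right, Complex.conj_ofReal] at e
  have e2 : ((s : ℂ) - t) * inner ℂ (x : H) (y : H) = 0 := by
    rw [sub_mul, sub_eq_zero]; exact e
  rcases mul_eq_zero.1 e2 with h0 | h0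
  · exact absurd (Complex.ofReal_injective (sub_eq_zero.1 h0)) hst
  · exact h0

theorem lowSpace_le_domain (t : ℝ) : lowSpace A t ≤ A.domain :=
  iSup_le fun s => eigenspace_le_domain s

/-- A sum of mutually orthogonal eigenvectors has no cross terms in the form or in the norm, so the
bound holds term by term. -/
theorem IsDiagonalAdd.re_inner_le_of_mem_lowSpace (h : IsDiagonalAdd A b μ V) {t : ℝ} {u : H}
    (hu : u ∈ lowSpace A t) (hd : u ∈ A.domain) :
    (inner ℂ u (A ⟨u, hd⟩)).re ≤ t * ‖u‖ ^ 2 := by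
  classical
  obtain ⟨f, hf, rfl⟩ := (Submodule.mem_iSup_iff_exists_finsupp _ _).1 hu
  have hof : OrthogonalFamily ℂ (fun s : Set.Iic t => eigenspace A (s : ℝ))
      fun s => (eigenspace A (s : ℝ)).subtypeₗᵢ := h.orthogonalFamily.comp Subtype.val_injective
  have hAf : ∀ s, ∃ hs : f s ∈ A.domain, A ⟨f s, hs⟩ = ((s : ℝ) : ℂ) • f s :=
    fun s => mem_eigenspace.1 (hf s)
  choose hfd hfA using hAf
  have hsum : (⟨f.sum fun _ x => x, hd⟩ : A.domain) = ∑ s ∈ f.support, ⟨f s, hfd s⟩ := by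
    ext
    simp [Finsupp.sum]
  have hA : A ⟨f.sum fun _ x => x, hd⟩ = ∑ s ∈ f.support, ((s : ℝ) : ℂ) • f s := by
    rw [hsum, ← LinearPMap.toFun_eq_coe, map_sum]
    exact Finset.sum_congr rfl fun s _ => hfA s
  have h1 := hof.inner_sum (fun s => ⟨f s, hf s⟩)
    (fun s => ((s : ℝ) : ℂ) • ⟨f s, hf s⟩) f.support
  have h2 := hof.norm_sum (fun s => ⟨f s, hf s⟩) f.support
  change inner ℂ (∑ s ∈ f.support, f s) (∑ s ∈ f.support, ((s : ℝ) : ℂ) • f s)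
    = ∑ s ∈ f.support, inner ℂ (f s) (((s : ℝ) : ℂ) • f s) at h1
  change ‖∑ s ∈ f.support, f s‖ ^ 2 = ∑ s ∈ f.support, ‖f s‖ ^ 2 at h2
  rw [hA, Finsupp.sum, h1, h2, Complex.re_sum, Finset.mul_sum]
  refine Finset.sum_le_sum fun s _ => ?_
  rw [inner_smul_right, Complex.re_ofReal_mul, ← RCLike.re_eq_complex_re, inner_self_eq_norm_sq]
  exact mul_le_mul_of_nonneg_right s.2 (by positivity)

/-- The coefficients on the `b n` with `μ n ≤ t` determine a vector of `lowSpace A t`: a nonzero one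
with all of them zero would have form both at most and above `t * ‖u‖ ^ 2`. This half of min-max
bounds eigenvalues from below. -/
theorem IsDiagonalAdd.rank_lowSpace_le (h : IsDiagonalAdd A b μ V) (t : ℝ) :
    Module.rank ℂ (lowSpace A t) ≤ (({n | μ n ≤ t}.ncard : ℕ) : Cardinal) := by
  have hfin := (h.finite t).to_subtype
  have := Fintype.ofFinite {n | μ n ≤ t}
  let P : lowSpace A t →ₗ[ℂ] ({n | μ n ≤ t} → ℂ) :=
    LinearMap.pi fun n => (innerSL ℂ (b n)).toLinearMap ∘ₗ (lowSpace A t).subtype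
  have hP : Function.Injective P := by
    rw [← LinearMap.ker_eq_bot, LinearMap.ker_eq_bot']
    intro u hu
    by_contra hne
    have hd := lowSpace_le_domain t u.2
    refine absurd (h.re_inner_le_of_mem_lowSpace u.2 hd) (not_le.2 ?_)
    refine h.lt_re_inner (u := ⟨u, hd⟩) (fun n hn => ?_) (by simpa using hne)
    exact congrFun hu ⟨n, hn⟩
  have h1 := LinearMap.lift_rank_le_of_injective P hP
  rw [rank_fun', Cardinal.lift_natCast, Cardinal.lift_le_nat_iff,
    Fintype.card_eq_nat_card, Nat.card_coe_set_eq] at h1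
  exact h1

theorem IsDiagonalAdd.finiteDimensional_lowSpace (h : IsDiagonalAdd A b μ V) (t : ℝ) :
    FiniteDimensional ℂ (lowSpace A t) := by
  refine Module.rank_lt_aleph0_iff.1 ((h.rank_lowSpace_le t).trans_lt (Cardinal.natCast_lt_aleph0))

theorem IsDiagonalAdd.finiteDimensional_eigenspace (h : IsDiagonalAdd A b μ V) (t : ℝ) :
    FiniteDimensional ℂ (eigenspace A t) :=
  have := h.finiteDimensional_lowSpace t
  Submodule.finiteDimensional_of_le (eigenspace_le_lowSpace le_rfl)

/-- Orthonormal bases of all the eigenspaces unite to a Hilbert basis of `H`. By symmetry `A` acts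
on coefficients as multiplication by the eigenvalue, so `lt_re_inner_of_diagonal` applies with
eigenvalues as weights. -/
theorem IsDiagonalAdd.lt_re_inner_of_orthogonal_lowSpace [CompleteSpace H]
    (h : IsDiagonalAdd A b μ V) {t : ℝ}
    {u : A.domain} (hu : (u : H) ∈ (lowSpace A t)ᗮ) (hu0 : (u : H) ≠ 0) :
    t * ‖(u : H)‖ ^ 2 < (inner ℂ (u : H) (A u)).re := by
  have hfd := h.finiteDimensional_eigenspace
  have hon := h.orthogonalFamily.orthonormal_sigma_orthonormal
    (v_family := fun s => stdOrthonormalBasis ℂ (eigenspace A s))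
    (fun s => (stdOrthonormalBasis ℂ (eigenspace A s)).orthonormal)
  have hsp : (Submodule.span ℂ (Set.range fun a : Σ s : ℝ, Fin (Module.finrank ℂ (eigenspace A s))
      => (eigenspace A a.1).subtypeₗᵢ (stdOrthonormalBasis ℂ (eigenspace A a.1) a.2)))ᗮ = ⊥ := by
    rw [eq_bot_iff, ← h.orthogonal_iSup_eigenspace]
    refine Submodule.orthogonal_le (iSup_le fun s x hx => ?_)
    have e := (stdOrthonormalBasis ℂ (eigenspace A s)).sum_repr ⟨x, hx⟩
    have e2 : ((_ : eigenspace A s) : H) = x := congrArg Subtype.val e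
    rw [← e2, Submodule.coe_sum]
    refine Submodule.sum_mem _ fun i _ => ?_
    rw [Submodule.coe_smul]
    exact Submodule.smul_mem _ _ (Submodule.subset_span ⟨⟨s, i⟩, rfl⟩)
  let e := HilbertBasis.mkOfOrthogonalEqBot hon hsp
  have he : ∀ a, e a = (stdOrthonormalBasis ℂ (eigenspace A a.1) a.2 : H) := fun a =>
    congrFun (HilbertBasis.coe_mkOfOrthogonalEqBot hon hsp) a
  refine lt_re_inner_of_diagonal e (μ := fun a => a.1) (fun a => ?_) (fun a ha => ?_) hu0
  · obtain ⟨hx, hx'⟩ := mem_eigenspace.1 (stdOrthonormalBasis ℂ (eigenspace A a.1) a.2).2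
    have hs := h.symmetric ⟨_, hx⟩ u
    rw [hx', inner_smul_left, Complex.conj_ofReal] at hs
    rw [he]
    exact hs.symm
  · refine Submodule.mem_orthogonal _ _ |>.1 hu _ ?_
    rw [he]
    exact eigenspace_le_lowSpace ha (stdOrthonormalBasis ℂ (eigenspace A a.1) a.2).2

/-- The min-max upper bound: a trial space gives eigenvectors. -/
theorem IsDiagonalAdd.finrank_le_rank_lowSpace [CompleteSpace H] (h : IsDiagonalAdd A b μ V)
    {t : ℝ} (F : Submodule ℂ H) [FiniteDimensional ℂ F] (hF : F ≤ A.domain)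
    (hFt : ∀ u : A.domain, (u : H) ∈ F → (inner ℂ (u : H) (A u)).re ≤ t * ‖(u : H)‖ ^ 2) :
    ((Module.finrank ℂ F : ℕ) : Cardinal) ≤ Module.rank ℂ (lowSpace A t) := by
  have hfd := h.finiteDimensional_lowSpace t
  rw [← Module.finrank_eq_rank, Nat.cast_le]
  by_contra! hlt
  -- If `F` had larger dimension than `lowSpace A t`, some nonzero vector of `F` would be orthogonal
  -- to it.
  have hk := LinearMap.ker_ne_bot_of_finrank_lt
    (f := ((lowSpace A t).orthogonalProjectionOnto : H →ₗ[ℂ] lowSpace A t) ∘ₗ F.subtype) hlt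
  obtain ⟨u, hu, hu0⟩ := Submodule.exists_mem_ne_zero_of_ne_bot hk
  have huo : (u : H) ∈ (lowSpace A t)ᗮ := by
    rw [← Submodule.orthogonalProjectionOnto_eq_zero_iff]
    exact hu
  exact absurd (hFt ⟨u, hF u.2⟩ u.2)
    (not_le.2 (h.lt_re_inner_of_orthogonal_lowSpace (u := ⟨u, hF u.2⟩) huo (by simpa using hu0)))

/-- One eigenvector per eigenvalue gives an independent family in the finite-dimensional `lowSpace A
t`. -/
theorem IsDiagonalAdd.finite_eigenvalues (h : IsDiagonalAdd A b μ V) (t : ℝ) :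
    {s : ℝ | s ≤ t ∧ eigenspace A s ≠ ⊥}.Finite := by
  have hfd := h.finiteDimensional_lowSpace t
  have hex : ∀ s : {s : ℝ | s ≤ t ∧ eigenspace A s ≠ ⊥}, ∃ x ∈ eigenspace A (s : ℝ), x ≠ 0 :=
    fun s => Submodule.exists_mem_ne_zero_of_ne_bot s.2.2
  choose x hx hx0 using hex
  have hli : LinearIndependent ℂ x := by
    refine linearIndependent_of_ne_zero_of_inner_eq_zero hx0 fun s s' hss => ?_
    exact h.orthogonalFamily (fun e => hss (Subtype.ext e)) ⟨x s, hx s⟩ ⟨x s', hx s'⟩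
  have hli2 : LinearIndependent ℂ (fun s => (⟨x s, eigenspace_le_lowSpace s.2.1 (hx s)⟩ :
      lowSpace A t)) := by
    refine LinearIndependent.of_comp (lowSpace A t).subtype ?_
    exact hli
  have := hli2.finite
  exact Set.toFinite _

/-- The trial space makes `t` admissible. The minimum is attained because `lowSpace` grows only at
eigenvalues, of which finitely many lie below `t`. -/
theorem IsDiagonalAdd.exists_isNthEigenvalue [CompleteSpace H] (h : IsDiagonalAdd A b μ V)
    {t : ℝ} {k : ℕ} (F : Submodule ℂ H) (hFk : Module.finrank ℂ F = k + 1) (hF : F ≤ A.domain)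
    (hFt : ∀ u : A.domain, (u : H) ∈ F → (inner ℂ (u : H) (A u)).re ≤ t * ‖(u : H)‖ ^ 2) :
    ∃ lam ≤ t, IsNthEigenvalue A k lam := by
  have : FiniteDimensional ℂ F := Module.finite_of_finrank_pos (by omega)
  set T : Set ℝ := {s : ℝ | ((k + 1 : ℕ) : Cardinal) ≤ Module.rank ℂ (lowSpace A s)} with hT
  have htT : t ∈ T := by
    rw [hT, Set.mem_ofPred_eq, ← hFk]
    exact h.finrank_le_rank_lowSpace F hF hFt
  set E : Set ℝ := {s : ℝ | s ≤ t ∧ eigenspace A s ≠ ⊥} with hE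
  -- An admissible `s` can be lowered to the largest eigenvalue not above it without shrinking
  -- `lowSpace`.
  have key : ∀ s ∈ T, s ≤ t → ∃ r ∈ T ∩ E, r ≤ s := by
    intro s hs hst
    have hfin : (E ∩ Set.Iic s).Finite := (h.finite_eigenvalues t).inter_of_left _
    have hsup : ∀ r, (∀ q ∈ E ∩ Set.Iic s, q ≤ r) → lowSpace A s ≤ lowSpace A r := by
      intro r hr
      refine iSup_le fun q => ?_
      by_cases hq : eigenspace A (q : ℝ) = ⊥
      · rw [hq]; exact bot_le
      · exact eigenspace_le_lowSpace (hr q ⟨⟨q.2.trans hst, hq⟩, q.2⟩)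
    have hne : (E ∩ Set.Iic s).Nonempty := by
      by_contra hem
      rw [Set.not_nonempty_iff_eq_empty] at hem
      have hb : lowSpace A s = ⊥ := by
        refine eq_bot_iff.2 (iSup_le fun q => ?_)
        by_contra hq
        have : (q : ℝ) ∈ E ∩ Set.Iic s := ⟨⟨q.2.trans hst, fun h0 => hq (h0 ▸ le_rfl)⟩, q.2⟩
        rw [hem] at this
        exact this
      rw [hT, Set.mem_ofPred_eq, hb, rank_bot] at hs
      exact absurd hs (by simp)
    obtain ⟨r, hr, hmax⟩ := Set.exists_max_image _ id hfin hne
    refine ⟨r, ⟨?_, hr.1⟩, hr.2⟩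
    rw [hT, Set.mem_ofPred_eq] at hs ⊢
    exact hs.trans (Submodule.rank_mono (hsup r hmax))
  obtain ⟨r, hr, hrt⟩ := key t htT le_rfl
  obtain ⟨lam, hlam, hmin⟩ := Set.exists_min_image (T ∩ E) id
    ((h.finite_eigenvalues t).inter_of_right _) ⟨r, hr⟩
  refine ⟨lam, hlam.2.1, hlam.1, fun s hs => ?_⟩
  rcases le_total s t with hst | hst
  · obtain ⟨q, hq, hqs⟩ := key s hs hst
    exact (hmin q hq).trans hqs
  · exact hlam.2.1.trans hst

/-- If `lam < m`, at most `k` of the `μ n` are `≤ lam`, too few for `rank_lowSpace_le`. Counting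
strictly below `m` allows `m` to be one of the `μ n`. -/
theorem IsDiagonalAdd.le_of_isNthEigenvalue (h : IsDiagonalAdd A b μ V) {k : ℕ} {lam m : ℝ}
    (hlam : IsNthEigenvalue A k lam) (hm : {n | μ n < m}.ncard ≤ k) : m ≤ lam := by
  by_contra! hlt
  have h1 : ((k + 1 : ℕ) : Cardinal) ≤ (({n | μ n ≤ lam}.ncard : ℕ) : Cardinal) :=
    le_trans (α := Cardinal) hlam.1 (h.rank_lowSpace_le lam)
  have h2 : {n | μ n ≤ lam}.ncard ≤ {n | μ n < m}.ncard :=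
    Set.ncard_le_ncard (fun n hn => lt_of_le_of_lt hn hlt)
      ((h.finite m).subset fun n (hn : μ n < m) => hn.le)
  rw [Nat.cast_le] at h1
  omega

end Operator

/-! ### Products of one-variable functions on the cube -/

section ProductFunctions

variable {d : ℕ}

/-- The product function `x ↦ ∏_j f_j(x_j)`. -/
noncomputable def prodFn (f : Fin d → ℝ → ℝ) (x : EuclideanSpace ℝ (Fin d)) : ℂ :=
  ((∏ j, f j (x j) : ℝ) : ℂ)

theorem prodFn_continuous {f : Fin d → ℝ → ℝ} (hf : ∀ j, Continuous (f j)) :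
    Continuous (prodFn f) := by
  unfold prodFn
  refine Complex.continuous_ofReal.comp (continuous_finsetProd _ fun j _ => (hf j).comp ?_)
  fun_prop

theorem prodFn_contDiff {f : Fin d → ℝ → ℝ} (hf : ∀ j, ContDiff ℝ ∞ (f j)) :
    ContDiff ℝ ∞ (prodFn f) := by
  have h : ContDiff ℝ ∞ fun x : EuclideanSpace ℝ (Fin d) => ∏ j, f j (x j) :=
    contDiff_prod fun j _ => (hf j).comp (by fun_prop)
  exact Complex.ofRealCLM.contDiff.comp h

theorem prodFn_mul (f g : Fin d → ℝ → ℝ) (x : EuclideanSpace ℝ (Fin d)) :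
    prodFn f x * prodFn g x = prodFn (fun j t => f j t * g j t) x := by
  simp only [prodFn, ← Complex.ofReal_mul, Finset.prod_mul_distrib]

theorem prodFn_update_mul (f : Fin d → ℝ → ℝ) (i : Fin d) (g : ℝ → ℝ)
    (x : EuclideanSpace ℝ (Fin d)) :
    prodFn (Function.update f i g) x = ((g (x i) * ∏ j ∈ Finset.univ.erase i, f j (x j) : ℝ) : ℂ) := by
  rw [prodFn, ← Finset.mul_prod_erase _ _ (Finset.mem_univ i), Function.update_self]
  congr 2
  refine Finset.prod_congr rfl fun j hj => ?_
  rw [Function.update_of_ne (Finset.ne_of_mem_erase hj)]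

/-- Along the line in direction `i` only the `i`-th factor varies, so the line derivative is
one-dimensional. -/
theorem partialDeriv_prodFn {f f' : Fin d → ℝ → ℝ} (hf : ∀ j t, HasDerivAt (f j) (f' j t) t)
    (i : Fin d) (x : EuclideanSpace ℝ (Fin d)) :
    partialDeriv i (prodFn f) x = prodFn (Function.update f i (f' i)) x := by
  have hd : DifferentiableAt ℝ (prodFn f) x := by
    have h : DifferentiableAt ℝ (fun x : EuclideanSpace ℝ (Fin d) => ∏ j, f j (x j)) x :=
      (HasFDerivAt.finsetProd (u := Finset.univ)
        (g := fun j (x : EuclideanSpace ℝ (Fin d)) => f j (x j)) fun j _ =>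
        ((hf j _).differentiableAt.comp x (f := fun x : EuclideanSpace ℝ (Fin d) => x j)
          (by fun_prop)).hasFDerivAt).differentiableAt
    exact Complex.ofRealCLM.differentiableAt.comp x h
  rw [partialDeriv, ← hd.lineDeriv_eq_fderiv, prodFn_update_mul]
  have e : ∀ t : ℝ, prodFn f (x + t • EuclideanSpace.single i 1)
      = ((f i (x i + t) * ∏ j ∈ Finset.univ.erase i, f j (x j) : ℝ) : ℂ) := by
    intro t
    rw [prodFn, ← Finset.mul_prod_erase _ _ (Finset.mem_univ i)]
    congr 2
    · simp
    · refine Finset.prod_congr rfl fun j hj => ?_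
      simp [Finset.ne_of_mem_erase hj]
  have h : HasDerivAt (fun t : ℝ => prodFn f (x + t • EuclideanSpace.single i 1))
      ((f' i (x i) * ∏ j ∈ Finset.univ.erase i, f j (x j) : ℝ) : ℂ) 0 := by
    simp only [e]
    refine HasDerivAt.ofReal_comp ?_
    refine HasDerivAt.mul_const ?_ _
    have := (hf i (x i + 0)).comp_const_add (x i) 0
    simpa using this
  exact h.deriv

/-- The closed cube. -/
def closedCube (d : ℕ) (L : ℝ) : Set (EuclideanSpace ℝ (Fin d)) :=
  {x | ∀ i, x i ∈ Set.Icc (-(L / 2)) (L / 2)}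

theorem isCompact_closedCube (d : ℕ) (L : ℝ) : IsCompact (closedCube d L) := by
  have h : IsCompact (Set.univ.pi fun _ : Fin d => Set.Icc (-(L / 2)) (L / 2)) :=
    isCompact_univ_pi fun _ => isCompact_Icc
  have h2 := h.image (PiLp.continuous_toLp 2 fun _ : Fin d => ℝ)
  convert h2 using 1
  ext x
  simp only [closedCube, Set.mem_ofPred_eq, Set.mem_image, Set.mem_univ_pi]
  constructor
  · exact fun hx => ⟨x.ofLp, hx, rfl⟩
  · rintro ⟨y, hy, rfl⟩
    exact hy

theorem cube_subset_closedCube (d : ℕ) (L : ℝ) : cube d L ⊆ closedCube d L :=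
  fun _ hx i => ⟨(hx i).1.le, (hx i).2.le⟩

instance isFiniteMeasure_restrict_cube (d : ℕ) (L : ℝ) :
    IsFiniteMeasure ((volume : Measure (EuclideanSpace ℝ (Fin d))).restrict (cube d L)) :=
  ⟨by
    rw [Measure.restrict_apply_univ]
    exact (measure_mono (cube_subset_closedCube d L)).trans_lt
      (isCompact_closedCube d L).measure_lt_top⟩

theorem memLp_cube_of_continuous {L : ℝ} {g : EuclideanSpace ℝ (Fin d) → ℂ} (hg : Continuous g)
    (p : ℝ≥0∞) : MemLp g p (volume.restrict (cube d L)) := by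
  obtain ⟨C, hC⟩ := (isCompact_closedCube d L).exists_bound_of_continuousOn hg.continuousOn
  refine MemLp.of_bound hg.aestronglyMeasurable C ?_
  exact (ae_restrict_iff' (isOpen_cube d L).measurableSet).2
    (Eventually.of_forall fun x hx => hC x (cube_subset_closedCube d L hx))

theorem integral_cube_prodFn (L : ℝ) (f : Fin d → ℝ → ℝ) :
    ∫ x in cube d L, prodFn f x
      = ((∏ j, ∫ t in Set.Ioo (-(L / 2)) (L / 2), f j t : ℝ) : ℂ) := by
  have hc : cube d L = (WithLp.ofLp : EuclideanSpace ℝ (Fin d) → (Fin d → ℝ)) ⁻¹'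
      (Set.univ.pi fun _ => Set.Ioo (-(L / 2)) (L / 2)) := by
    ext x
    simp [cube]
  have hmp := PiLp.volume_preserving_ofLp (Fin d)
  have he : MeasurableEmbedding (WithLp.ofLp : EuclideanSpace ℝ (Fin d) → (Fin d → ℝ)) :=
    (MeasurableEquiv.toLp 2 (Fin d → ℝ)).symm.measurableEmbedding
  have h1 := hmp.setIntegral_preimage_emb he
    (fun y : Fin d → ℝ => ∏ j, f j (y j)) (Set.univ.pi fun _ => Set.Ioo (-(L / 2)) (L / 2))
  rw [volume_pi, Measure.restrict_pi_pi, integral_fintype_prod_eq_prod] at h1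
  rw [← h1, hc]
  exact integral_ofReal

end ProductFunctions

/-! ### Sines and cosines on the interval -/

section Trigonometric

/-- The normalized trigonometric functions of frequency `k` on `(-L/2, L/2)`: the cosine for
`p = true`, and the sine, which vanishes at the endpoints, for `p = false`. -/
noncomputable def trig (L : ℝ) (p : Bool) (k : ℕ) (t : ℝ) : ℝ :=
  √(2 / L) * cond p (Real.cos (k * Real.pi / L * (t + L / 2)))
    (Real.sin (k * Real.pi / L * (t + L / 2)))

/-- The factor in the derivative of `trig`. -/
noncomputable def trigFactor (L : ℝ) (p : Bool) (k : ℕ) : ℝ :=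
  cond p (-(k * Real.pi / L)) (k * Real.pi / L)

/-- Differentiation only flips the Boolean and multiplies by a constant, so all derivatives of sine
products stay in one family. -/
theorem hasDerivAt_trig (L : ℝ) (p : Bool) (k : ℕ) (t : ℝ) :
    HasDerivAt (trig L p k) (trigFactor L p k * trig L (!p) k t) t := by
  have h : HasDerivAt (fun t : ℝ => k * Real.pi / L * (t + L / 2)) (k * Real.pi / L) t := by
    simpa using ((hasDerivAt_id t).add_const (L / 2)).const_mul (k * Real.pi / L)
  cases p
  · refine (h.sin.const_mul √(2 / L)).congr_deriv ?_
    simp only [trigFactor, trig, cond_false, Bool.not_false, cond_true]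
    ring
  · refine (h.cos.const_mul √(2 / L)).congr_deriv ?_
    simp only [trigFactor, trig, cond_false, Bool.not_true, cond_true]
    ring

theorem contDiff_trig (L : ℝ) (p : Bool) (k : ℕ) : ContDiff ℝ ∞ (trig L p k) := by
  have h : ContDiff ℝ ∞ fun t : ℝ => k * Real.pi / L * (t + L / 2) := by fun_prop
  cases p
  · exact contDiff_const.mul h.sin
  · exact contDiff_const.mul h.cos

theorem abs_trig_le (L : ℝ) (p : Bool) (k : ℕ) (t : ℝ) : |trig L p k t| ≤ √(2 / L) := by
  rw [trig, abs_mul, abs_of_nonneg (Real.sqrt_nonneg _)]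
  refine mul_le_of_le_one_right (Real.sqrt_nonneg _) ?_
  cases p
  · exact Real.abs_sin_le_one _
  · exact Real.abs_cos_le_one _

theorem integral_cos_mul (L : ℝ) (hL : 0 < L) (m : ℤ) :
    ∫ t in (-(L / 2))..(L / 2), Real.cos (m * Real.pi / L * (t + L / 2))
      = if m = 0 then L else 0 := by
  split_ifs with hm
  · simp [hm]
  · have hc : (m : ℝ) * Real.pi / L ≠ 0 := by
      have : (m : ℝ) ≠ 0 := by exact_mod_cast hm
      positivity
    have hd : ∀ t ∈ Set.uIcc (-(L / 2)) (L / 2),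
        HasDerivAt (fun t : ℝ => Real.sin (m * Real.pi / L * (t + L / 2)) / (m * Real.pi / L))
          (Real.cos (m * Real.pi / L * (t + L / 2))) t := by
      intro t _
      have h : HasDerivAt (fun t : ℝ => m * Real.pi / L * (t + L / 2)) (m * Real.pi / L) t := by
        simpa using ((hasDerivAt_id t).add_const (L / 2)).const_mul (m * Real.pi / L)
      refine (h.sin.div_const _).congr_deriv ?_
      field_simp
    rw [intervalIntegral.integral_eq_sub_of_hasDerivAt hd
      (Continuous.intervalIntegrable (by fun_prop) _ _)]
    have e : (m : ℝ) * Real.pi / L * (L / 2 + L / 2) = m * Real.pi := by field_simp; ring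
    rw [e, Real.sin_int_mul_pi]
    simp

/-- Product-to-sum formulas. With frequencies at least one, the sum frequency `k + l + 2` never
vanishes; at frequency zero the normalization would fail. -/
theorem integral_trig_mul_trig {L : ℝ} (hL : 0 < L) (p : Bool) (k l : ℕ) :
    ∫ t in Set.Ioo (-(L / 2)) (L / 2), trig L p (k + 1) t * trig L p (l + 1) t
      = if k = l then 1 else 0 := by
  rw [← integral_Ioc_eq_integral_Ioo, ← intervalIntegral.integral_of_le (by linarith)]
  have h2 : √(2 / L) * √(2 / L) = 2 / L := Real.mul_self_sqrt (by positivity)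
  have e : ∀ t, trig L p (k + 1) t * trig L p (l + 1) t
      = 1 / L * (Real.cos (((k : ℤ) - l : ℤ) * Real.pi / L * (t + L / 2))
        + cond p 1 (-1) * Real.cos (((k : ℤ) + l + 2 : ℤ) * Real.pi / L * (t + L / 2))) := by
    intro t
    have e1 : (((k : ℤ) - l : ℤ) : ℝ) * Real.pi / L * (t + L / 2)
        = ((k + 1 : ℕ) : ℝ) * Real.pi / L * (t + L / 2)
          - ((l + 1 : ℕ) : ℝ) * Real.pi / L * (t + L / 2) := by
      push_cast; ring
    have e2 : (((k : ℤ) + l + 2 : ℤ) : ℝ) * Real.pi / L * (t + L / 2)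
        = ((k + 1 : ℕ) : ℝ) * Real.pi / L * (t + L / 2)
          + ((l + 1 : ℕ) : ℝ) * Real.pi / L * (t + L / 2) := by
      push_cast; ring
    rw [e1, e2, Real.cos_sub, Real.cos_add, trig, trig]
    cases p
    · simp only [cond_false]
      linear_combination (Real.sin (((k + 1 : ℕ) : ℝ) * Real.pi / L * (t + L / 2)) *
        Real.sin (((l + 1 : ℕ) : ℝ) * Real.pi / L * (t + L / 2))) * h2
    · simp only [cond_true]
      linear_combination (Real.cos (((k + 1 : ℕ) : ℝ) * Real.pi / L * (t + L / 2)) *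
        Real.cos (((l + 1 : ℕ) : ℝ) * Real.pi / L * (t + L / 2))) * h2
  simp only [e]
  rw [intervalIntegral.integral_const_mul, intervalIntegral.integral_add,
    intervalIntegral.integral_const_mul, integral_cos_mul L hL, integral_cos_mul L hL]
  · have h0 : (k : ℤ) + l + 2 ≠ 0 := by positivity
    rw [if_neg h0, mul_zero, add_zero]
    simp only [sub_eq_zero, Nat.cast_inj]
    split_ifs
    · field_simp
    · simp
  · exact Continuous.intervalIntegrable (by fun_prop) _ _
  · exact Continuous.intervalIntegrable (by fun_prop) _ _

end Trigonometric

/-! ### Trigonometric products as orthonormal families -/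

section Modes

variable {d : ℕ}

/-- The product of trigonometric functions with frequencies `k`. -/
noncomputable def modeFn (L : ℝ) (p : Fin d → Bool) (k : Fin d → ℕ) :
    EuclideanSpace ℝ (Fin d) → ℂ :=
  prodFn fun j => trig L (p j) (k j)

theorem contDiff_modeFn (L : ℝ) (p : Fin d → Bool) (k : Fin d → ℕ) :
    ContDiff ℝ ∞ (modeFn L p k) :=
  prodFn_contDiff fun _ => contDiff_trig _ _ _

theorem norm_modeFn_le (L : ℝ) (p : Fin d → Bool) (k : Fin d → ℕ)
    (x : EuclideanSpace ℝ (Fin d)) : ‖modeFn L p k x‖ ≤ √(2 / L) ^ d := by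
  rw [modeFn, prodFn, Complex.norm_real, Real.norm_eq_abs, Finset.abs_prod]
  calc ∏ j, |trig L (p j) (k j) (x j)| ≤ ∏ _j : Fin d, √(2 / L) :=
        Finset.prod_le_prod (fun _ _ => abs_nonneg _) fun _ _ => abs_trig_le _ _ _ _
    _ = √(2 / L) ^ d := by rw [Finset.prod_const, Finset.card_univ, Fintype.card_fin]

theorem prodFn_update_const_mul (f : Fin d → ℝ → ℝ) (i : Fin d) (c : ℝ) (g : ℝ → ℝ)
    (x : EuclideanSpace ℝ (Fin d)) :
    prodFn (Function.update f i fun t => c * g t) x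
      = (c : ℂ) * prodFn (Function.update f i g) x := by
  rw [prodFn_update_mul, prodFn_update_mul, ← Complex.ofReal_mul, mul_assoc]

theorem partialDeriv_modeFn (L : ℝ) (p : Fin d → Bool) (k : Fin d → ℕ) (i : Fin d)
    (x : EuclideanSpace ℝ (Fin d)) :
    partialDeriv i (modeFn L p k) x
      = (trigFactor L (p i) (k i) : ℂ) * modeFn L (Function.update p i (!p i)) k x := by
  rw [modeFn, partialDeriv_prodFn fun j t => hasDerivAt_trig L (p j) (k j) t,
    prodFn_update_const_mul, modeFn]
  congr 2
  funext j
  by_cases h : j = i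
  · subst h; simp
  · simp [h]

/-- The normalized trigonometric products as elements of `L²` of the cube. -/
noncomputable def mode (L : ℝ) (p : Fin d → Bool) (k : Fin d → ℕ) : L2 (cube d L) :=
  -- The index `k` stands for the frequencies `k j + 1`, whereas `modeFn` takes the frequencies
  -- themselves.
  (memLp_cube_of_continuous (contDiff_modeFn L p (fun j => k j + 1)).continuous 2).toLp

theorem coeFn_mode (L : ℝ) (p : Fin d → Bool) (k : Fin d → ℕ) :
    mode L p k =ᵐ[volume.restrict (cube d L)] modeFn L p (fun j => k j + 1) :=
  MemLp.coeFn_toLp _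

theorem conj_modeFn (L : ℝ) (p : Fin d → Bool) (k : Fin d → ℕ) (x : EuclideanSpace ℝ (Fin d)) :
    (starRingEnd ℂ) (modeFn L p k x) = modeFn L p k x := Complex.conj_ofReal _

theorem inner_mode (L : ℝ) (p : Fin d → Bool) (k : Fin d → ℕ) (u : L2 (cube d L)) :
    inner ℂ (mode L p k) u = ∫ x in cube d L, modeFn L p (fun j => k j + 1) x * u x := by
  rw [L2.inner_def]
  refine integral_congr_ae ?_
  filter_upwards [coeFn_mode L p k] with x hx
  rw [hx, RCLike.inner_apply, conj_modeFn, mul_comm]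

/-- Mixed patterns `p` are needed because differentiated sine series run over modes with some cosine
factors. -/
theorem orthonormal_mode {L : ℝ} (hL : 0 < L) (p : Fin d → Bool) :
    Orthonormal ℂ (mode L p : (Fin d → ℕ) → L2 (cube d L)) := by
  rw [orthonormal_iff_ite]
  intro k l
  have h1 : ∫ x in cube d L, modeFn L p (fun j => k j + 1) x * mode L p l x
      = ∫ x in cube d L, prodFn (fun j t => trig L (p j) (k j + 1) t * trig L (p j) (l j + 1) t) x := by
    refine integral_congr_ae ?_
    filter_upwards [coeFn_mode L p l] with x hx
    rw [hx, modeFn, modeFn, prodFn_mul]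
  rw [inner_mode, h1, integral_cube_prodFn]
  simp only [integral_trig_mul_trig hL]
  split_ifs with h
  · simp [h]
  · obtain ⟨j, hj⟩ := Function.ne_iff.1 h
    rw [Finset.prod_eq_zero (Finset.mem_univ j) (if_neg hj), Complex.ofReal_zero]

end Modes

/-! ### Weak derivatives through the bilinear pairing -/

section Pairing

variable {d : ℕ} {Ω : Set (EuclideanSpace ℝ (Fin d))}

/-- The bilinear pairing `∫ a u` on `L²`. -/
noncomputable def pairing (a u : L2 Ω) : ℂ :=
  inner ℂ (Complex.conjCLE.toContinuousLinearMap.compLpL 2 (volume.restrict Ω) a) u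

theorem pairing_eq_integral (a u : L2 Ω) : pairing a u = ∫ x in Ω, a x * u x := by
  rw [pairing, L2.inner_def]
  refine integral_congr_ae ?_
  filter_upwards [ContinuousLinearMap.coeFn_compLpL
    Complex.conjCLE.toContinuousLinearMap a] with x hx
  rw [hx, RCLike.inner_apply]
  simp [mul_comm]

theorem pairing_toLp_eq_integral {φ : EuclideanSpace ℝ (Fin d) → ℂ}
    (hφ : MemLp φ 2 (volume.restrict Ω)) (u : L2 Ω) :
    pairing hφ.toLp u = ∫ x in Ω, φ x * u x := by
  rw [pairing_eq_integral]
  refine integral_congr_ae ?_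
  filter_upwards [hφ.coeFn_toLp] with x hx
  rw [hx]

theorem continuous_pairing_left (u : L2 Ω) : Continuous fun a : L2 Ω => pairing a u := by
  unfold pairing
  fun_prop

theorem continuous_pairing_right (a : L2 Ω) : Continuous fun u : L2 Ω => pairing a u := by
  unfold pairing
  fun_prop

theorem pairing_comm (a u : L2 Ω) : pairing a u = pairing u a := by
  simp only [pairing_eq_integral, mul_comm]

/-- Expressed through continuous functionals, the defining identity passes to limits in `L²`. -/
theorem IsTestFunction.hasWeakDeriv_iff {i : Fin d} {u g : L2 Ω} :
    HasWeakDeriv Ω i u g ↔ ∀ (φ : EuclideanSpace ℝ (Fin d) → ℂ) (hφ : IsTestFunction Ω φ),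
      pairing (hφ.partialDeriv_memLp i).toLp u = - pairing hφ.memLp.toLp g := by
  simp only [pairing_toLp_eq_integral]
  exact Iff.rfl

/-- The weak derivative is a closed operator. -/
theorem HasWeakDeriv.of_tendsto {ι : Type*} {l : Filter ι} [l.NeBot] {i : Fin d}
    {u g : ι → L2 Ω} {u₀ g₀ : L2 Ω} (h : ∀ n, HasWeakDeriv Ω i (u n) (g n))
    (hu : Tendsto u l (𝓝 u₀)) (hg : Tendsto g l (𝓝 g₀)) : HasWeakDeriv Ω i u₀ g₀ := by
  rw [IsTestFunction.hasWeakDeriv_iff]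
  intro φ hφ
  have h1 := ((continuous_pairing_right (hφ.partialDeriv_memLp i).toLp).tendsto u₀).comp hu
  have h2 := ((continuous_pairing_right hφ.memLp.toLp).tendsto g₀).comp hg
  refine tendsto_nhds_unique h1 (h2.neg.congr fun n => ?_)
  exact (IsTestFunction.hasWeakDeriv_iff.1 (h n) φ hφ).symm

theorem HasWeakDeriv.sum {ι : Type*} {i : Fin d} {u g : ι → L2 Ω} (s : Finset ι)
    (h : ∀ n, HasWeakDeriv Ω i (u n) (g n)) :
    HasWeakDeriv Ω i (∑ n ∈ s, u n) (∑ n ∈ s, g n) := by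
  classical
  induction s using Finset.induction_on with
  | empty => simpa using HasWeakDeriv.zero
  | insert a s ha ih =>
    rw [Finset.sum_insert ha, Finset.sum_insert ha]
    exact (h a).add ih

theorem HasWeakDeriv.of_hasSum {ι : Type*} {i : Fin d} {u g : ι → L2 Ω} {u₀ g₀ : L2 Ω}
    (h : ∀ n, HasWeakDeriv Ω i (u n) (g n)) (hu : HasSum u u₀) (hg : HasSum g g₀) :
    HasWeakDeriv Ω i u₀ g₀ :=
  HasWeakDeriv.of_tendsto (fun s => HasWeakDeriv.sum s h) hu hg

theorem tendsto_toLp_of_eLpNorm {μ : Measure (EuclideanSpace ℝ (Fin d))}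
    {w : Lp ℂ 2 μ} {φ : ℕ → EuclideanSpace ℝ (Fin d) → ℂ}
    (hφ : ∀ n, MemLp (φ n) 2 μ)
    (h : Tendsto (fun n => eLpNorm (fun x => w x - φ n x) 2 μ) atTop (𝓝 0)) :
    Tendsto (fun n => (hφ n).toLp) atTop (𝓝 w) := by
  rw [Lp.tendsto_Lp_iff_tendsto_eLpNorm']
  refine h.congr fun n => ?_
  rw [eLpNorm_congr_ae (((hφ n).coeFn_toLp).sub (EventuallyEq.refl _ _)), eLpNorm_sub_comm]
  rfl

/-- Integration by parts for functions in `H^1_0`. -/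
theorem MemH10.pairing_eq {i : Fin d} {w g g' : L2 Ω} (hw : MemH10 Ω w)
    (hg : HasWeakDeriv Ω i g g') : pairing w g' = - pairing (weakDeriv Ω i w) g := by
  obtain ⟨_, φ, hφ, h0, h1⟩ := hw
  have t0 := tendsto_toLp_of_eLpNorm (fun n => (hφ n).memLp) h0
  have t1 := tendsto_toLp_of_eLpNorm (fun n => (hφ n).partialDeriv_memLp i) (h1 i)
  have h2 := ((continuous_pairing_left g').tendsto w).comp t0
  have h3 := ((continuous_pairing_left g).tendsto (weakDeriv Ω i w)).comp t1
  refine tendsto_nhds_unique h2 (h3.neg.congr fun n => ?_)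
  rw [Function.comp_apply, Function.comp_apply, IsTestFunction.hasWeakDeriv_iff.1 hg _ (hφ n),
    neg_neg]

/-- The classical derivative of a smooth function is its weak derivative. -/
theorem hasWeakDeriv_toLp {i : Fin d} {f f' : EuclideanSpace ℝ (Fin d) → ℂ}
    (hf : ContDiff ℝ ∞ f) (hff' : ∀ x, partialDeriv i f x = f' x)
    (h1 : MemLp f 2 (volume.restrict Ω)) (h2 : MemLp f' 2 (volume.restrict Ω)) :
    HasWeakDeriv Ω i h1.toLp h2.toLp := by
  intro φ hφ
  have hd : Differentiable ℝ f := hf.differentiable (by simp)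
  have hφd : Differentiable ℝ φ := hφ.smooth.differentiable (by simp)
  have hpc : ∀ {ψ : EuclideanSpace ℝ (Fin d) → ℂ}, ContDiff ℝ ∞ ψ →
      Continuous (partialDeriv i ψ) := fun hψ =>
    (hψ.continuous_fderiv (by simp)).clm_apply continuous_const
  have hps : HasCompactSupport (partialDeriv i φ) :=
    (hφ.compact.fderiv (𝕜 := ℝ)).comp_left
      (g := fun T : EuclideanSpace ℝ (Fin d) →L[ℝ] ℂ => T (EuclideanSpace.single i 1)) rfl
  have key := integral_mul_fderiv_eq_neg_fderiv_mul_of_integrable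
    (μ := (volume : Measure (EuclideanSpace ℝ (Fin d)))) (f := f) (g := φ)
    (v := EuclideanSpace.single i 1)
    (((hpc hf).mul hφ.smooth.continuous).integrable_of_hasCompactSupport hφ.compact.mul_left)
    ((hf.continuous.mul (hpc hφ.smooth)).integrable_of_hasCompactSupport hps.mul_left)
    ((hf.continuous.mul hφ.smooth.continuous).integrable_of_hasCompactSupport hφ.compact.mul_left)
    (fun x _ => hd x) (fun x _ => hφd x)
  -- The test function vanishes off `Ω`, so the integrals extend to the whole space, where
  -- integration by parts has no boundary terms.
  have hz : ∀ x, x ∉ Ω → φ x = 0 := fun x hx =>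
    image_eq_zero_of_notMem_tsupport fun h => hx (hφ.support h)
  have hz' : ∀ x, x ∉ Ω → partialDeriv i φ x = 0 := by
    intro x hx
    have : fderiv ℝ φ x = 0 := by
      refine image_eq_zero_of_notMem_tsupport fun h => hx (hφ.support ?_)
      exact tsupport_fderiv_subset ℝ h
    rw [partialDeriv, this]
    rfl
  have e1 : ∫ x in Ω, partialDeriv i φ x * (h1.toLp f) x = ∫ x, f x * partialDeriv i φ x := by
    rw [← setIntegral_eq_integral_of_forall_compl_eq_zero (s := Ω)
      (f := fun x => f x * partialDeriv i φ x) (fun x hx => by rw [hz' x hx, mul_zero])]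
    refine integral_congr_ae ?_
    filter_upwards [h1.coeFn_toLp] with x hx
    rw [hx, mul_comm]
  have e2 : ∫ x in Ω, φ x * (h2.toLp f') x = ∫ x, partialDeriv i f x * φ x := by
    rw [← setIntegral_eq_integral_of_forall_compl_eq_zero (s := Ω)
      (f := fun x => partialDeriv i f x * φ x) (fun x hx => by rw [hz x hx, mul_zero])]
    refine integral_congr_ae ?_
    filter_upwards [h2.coeFn_toLp] with x hx
    rw [hx, hff', mul_comm]
  rw [e1, e2]
  exact key

theorem hasWeakDeriv_mode (L : ℝ) (p : Fin d → Bool) (k : Fin d → ℕ) (i : Fin d) :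
    HasWeakDeriv (cube d L) i (mode L p k)
      ((trigFactor L (p i) (k i + 1) : ℂ) • mode L (Function.update p i (!p i)) k) := by
  have h2 := memLp_cube_of_continuous (L := L)
    (contDiff_modeFn L (Function.update p i (!p i)) (fun j => k j + 1)).continuous 2
  have h := hasWeakDeriv_toLp (contDiff_modeFn L p fun j => k j + 1)
    (partialDeriv_modeFn L p (fun j => k j + 1) i)
    (memLp_cube_of_continuous (contDiff_modeFn L p (fun j => k j + 1)).continuous 2)
    (h2.const_mul (trigFactor L (p i) (k i + 1) : ℂ))
  exact h

end Pairing

/-! ### Cutoffs near the endpoints -/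

section Cutoff

theorem smoothTransition_hasDerivAt (y : ℝ) :
    HasDerivAt Real.smoothTransition (deriv Real.smoothTransition y) y :=
  ((Real.smoothTransition.contDiff (n := 1)).differentiable (by simp) y).hasDerivAt

theorem deriv_smoothTransition_eq_zero {y : ℝ} (hy : y < 0 ∨ 1 < y) :
    deriv Real.smoothTransition y = 0 := by
  rcases hy with hy | hy
  · have : Real.smoothTransition =ᶠ[𝓝 y] fun _ => 0 := by
      filter_upwards [eventually_lt_nhds hy] with z hz
      exact Real.smoothTransition.zero_of_nonpos hz.le
    rw [this.deriv_eq, deriv_const]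
  · have : Real.smoothTransition =ᶠ[𝓝 y] fun _ => 1 := by
      filter_upwards [eventually_gt_nhds hy] with z hz
      exact Real.smoothTransition.one_of_one_le hz.le
    rw [this.deriv_eq, deriv_const]

/-- Here `y` plays the role of `n` times the distance to an endpoint: the cutoff derivative has size
`n`, but only where that distance is of order `1 / n`. -/
theorem exists_bound_mul_deriv_smoothTransition :
    ∃ K : ℝ, 0 ≤ K ∧ ∀ y, |y * deriv Real.smoothTransition (y - 1)| ≤ K := by
  have hc : Continuous fun y : ℝ => y * deriv Real.smoothTransition (y - 1) :=
    continuous_id.mul (((Real.smoothTransition.contDiff (n := 1)).continuous_deriv le_rfl).comp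
      (continuous_id.sub continuous_const))
  have hs : HasCompactSupport fun y : ℝ => y * deriv Real.smoothTransition (y - 1) := by
    refine HasCompactSupport.intro (isCompact_Icc (a := (1 : ℝ)) (b := 2)) fun y hy => ?_
    rw [deriv_smoothTransition_eq_zero, mul_zero]
    by_contra! h
    exact hy ⟨by linarith [h.1], by linarith [h.2]⟩
  obtain ⟨K, hK⟩ := hs.exists_bound_of_continuous hc
  exact ⟨K, (norm_nonneg _).trans (hK 0), hK⟩

/-- A smooth function supported in `(-L/2, L/2)`, equal to `1` at distance more than `2/n`
from the endpoints. -/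
noncomputable def cutoff (L : ℝ) (n : ℕ) (t : ℝ) : ℝ :=
  Real.smoothTransition (n * (t + L / 2) - 1) * Real.smoothTransition (n * (L / 2 - t) - 1)

/-- The derivative of `cutoff`. -/
noncomputable def cutoffDeriv (L : ℝ) (n : ℕ) (t : ℝ) : ℝ :=
  n * deriv Real.smoothTransition (n * (t + L / 2) - 1)
      * Real.smoothTransition (n * (L / 2 - t) - 1)
    - Real.smoothTransition (n * (t + L / 2) - 1)
      * (n * deriv Real.smoothTransition (n * (L / 2 - t) - 1))

theorem hasDerivAt_cutoff (L : ℝ) (n : ℕ) (t : ℝ) :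
    HasDerivAt (cutoff L n) (cutoffDeriv L n t) t := by
  have h1 : HasDerivAt (fun t : ℝ => n * (t + L / 2) - 1) n t := by
    simpa using (((hasDerivAt_id t).add_const (L / 2)).const_mul (n : ℝ)).sub_const 1
  have h2 : HasDerivAt (fun t : ℝ => n * (L / 2 - t) - 1) (-n) t := by
    simpa using (((hasDerivAt_id t).const_sub (L / 2)).const_mul (n : ℝ)).sub_const 1
  have h := ((smoothTransition_hasDerivAt _).comp t h1).mul
    ((smoothTransition_hasDerivAt _).comp t h2)
  refine h.congr_deriv ?_
  simp only [cutoffDeriv, Function.comp_apply]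
  ring

theorem contDiff_cutoff (L : ℝ) (n : ℕ) : ContDiff ℝ ∞ (cutoff L n) := by
  unfold cutoff
  exact (Real.smoothTransition.contDiff.comp (by fun_prop)).mul
    (Real.smoothTransition.contDiff.comp (by fun_prop))

theorem abs_cutoff_le (L : ℝ) (n : ℕ) (t : ℝ) : |cutoff L n t| ≤ 1 := by
  rw [cutoff, abs_of_nonneg (mul_nonneg (Real.smoothTransition.nonneg _)
    (Real.smoothTransition.nonneg _))]
  exact mul_le_one₀ (Real.smoothTransition.le_one _) (Real.smoothTransition.nonneg _)
    (Real.smoothTransition.le_one _)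

theorem cutoff_eq_zero (L : ℝ) {n : ℕ} (hn : 0 < n) {t : ℝ}
    (ht : t ∉ Set.Icc (-((L - 2 / n) / 2)) ((L - 2 / n) / 2)) : cutoff L n t = 0 := by
  have hn' : (0 : ℝ) < n := by exact_mod_cast hn
  have e : (n : ℝ) * (1 / n) = 1 := by field_simp
  by_cases h : t < -((L - 2 / n) / 2)
  · rw [cutoff, Real.smoothTransition.zero_of_nonpos, zero_mul]
    have : t + L / 2 ≤ 1 / n := by
      have : (2 : ℝ) / n = 2 * (1 / n) := by ring
      linarith
    have := mul_le_mul_of_nonneg_left this hn'.le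
    linarith
  · have h2 : (L - 2 / n) / 2 < t := by
      by_contra h2
      exact ht ⟨not_lt.1 h, not_lt.1 h2⟩
    rw [cutoff, Real.smoothTransition.zero_of_nonpos (x := n * (L / 2 - t) - 1), mul_zero]
    have : L / 2 - t ≤ 1 / n := by
      have : (2 : ℝ) / n = 2 * (1 / n) := by ring
      linarith
    have := mul_le_mul_of_nonneg_left this hn'.le
    linarith

theorem eventually_cutoff_eq (L : ℝ) {t : ℝ} (h1 : -(L / 2) < t) (h2 : t < L / 2) :
    ∀ᶠ n : ℕ in atTop, cutoff L n t = 1 ∧ cutoffDeriv L n t = 0 := by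
  have t1 : Tendsto (fun n : ℕ => (n : ℝ) * (t + L / 2)) atTop atTop :=
    tendsto_natCast_atTop_atTop.atTop_mul_const (by linarith)
  have t2 : Tendsto (fun n : ℕ => (n : ℝ) * (L / 2 - t)) atTop atTop :=
    tendsto_natCast_atTop_atTop.atTop_mul_const (by linarith)
  filter_upwards [t1.eventually_gt_atTop 2, t2.eventually_gt_atTop 2] with n hn1 hn2
  constructor
  · rw [cutoff, Real.smoothTransition.one_of_one_le (by linarith),
      Real.smoothTransition.one_of_one_le (by linarith), mul_one]
  · rw [cutoffDeriv, deriv_smoothTransition_eq_zero (Or.inr (by linarith)),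
      deriv_smoothTransition_eq_zero (Or.inr (by linarith))]
    ring

/-- A value `s` that is linearly small at both endpoints absorbs the factor `n`, uniformly in `n`;
the `2` counts the endpoints. -/
theorem exists_bound_mul_cutoffDeriv (L : ℝ) : ∃ K : ℝ, 0 ≤ K ∧ ∀ (M s t : ℝ) (n : ℕ),
    |s| ≤ M * |t + L / 2| → |s| ≤ M * |L / 2 - t| → 0 ≤ M →
      |s * cutoffDeriv L n t| ≤ 2 * (M * K) := by
  obtain ⟨K, hK0, hK⟩ := exists_bound_mul_deriv_smoothTransition
  refine ⟨K, hK0, fun M s t n h1 h2 hM => ?_⟩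
  have key : ∀ y : ℝ, |s| ≤ M * |y| →
      |s * (n * deriv Real.smoothTransition (n * y - 1))| ≤ M * K := by
    intro y hy
    calc |s * (n * deriv Real.smoothTransition (n * y - 1))|
        = |s| * |n * deriv Real.smoothTransition (n * y - 1)| := abs_mul _ _
      _ ≤ M * |y| * |n * deriv Real.smoothTransition (n * y - 1)| := by gcongr
      _ = M * |n * y * deriv Real.smoothTransition (n * y - 1)| := by
        rw [mul_assoc, ← abs_mul]
        congr 2
        ring
      _ ≤ M * K := by gcongr; exact hK _
  have b : ∀ y, |Real.smoothTransition y| ≤ 1 := fun y => by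
    rw [abs_of_nonneg (Real.smoothTransition.nonneg _)]
    exact Real.smoothTransition.le_one _
  have e : s * cutoffDeriv L n t
      = s * (n * deriv Real.smoothTransition (n * (t + L / 2) - 1))
          * Real.smoothTransition (n * (L / 2 - t) - 1)
        - s * (n * deriv Real.smoothTransition (n * (L / 2 - t) - 1))
          * Real.smoothTransition (n * (t + L / 2) - 1) := by
    rw [cutoffDeriv]; ring
  rw [e]
  refine (abs_sub _ _).trans ?_
  rw [abs_mul _ (Real.smoothTransition _), abs_mul _ (Real.smoothTransition _), two_mul]
  exact add_le_add
    ((mul_le_of_le_one_right (abs_nonneg _) (b _)).trans (key _ h1))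
    ((mul_le_of_le_one_right (abs_nonneg _) (b _)).trans (key _ h2))

end Cutoff

/-! ### Sine products belong to `H^1_0` -/

section SobolevZero

variable {d : ℕ}

theorem tendsto_eLpNorm_two_of_dominated {α E : Type*} [MeasurableSpace α] [NormedAddCommGroup E]
    {μ : Measure α} [IsFiniteMeasure μ] {f : ℕ → α → E} (hf : ∀ n, AEStronglyMeasurable (f n) μ)
    {C : ℝ} (hC : ∀ n, ∀ᵐ x ∂μ, ‖f n x‖ ≤ C)
    (h : ∀ᵐ x ∂μ, Tendsto (fun n => f n x) atTop (𝓝 0)) :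
    Tendsto (fun n => eLpNorm (f n) 2 μ) atTop (𝓝 0) := by
  have e : ∀ n, eLpNorm (f n) 2 μ = (∫⁻ x, ‖f n x‖ₑ ^ (2 : ℝ) ∂μ) ^ (1 / 2 : ℝ) := by
    intro n
    rw [eLpNorm_eq_lintegral_rpow_enorm_toReal (by norm_num) (by norm_num)]
    norm_num
  simp only [e]
  have key : Tendsto (fun n => ∫⁻ x, ‖f n x‖ₑ ^ (2 : ℝ) ∂μ) atTop (𝓝 (∫⁻ _, 0 ∂μ)) := by
    refine tendsto_lintegral_of_dominated_convergence' (fun _ => (ENNReal.ofReal C) ^ (2 : ℝ))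
      (fun n => (hf n).enorm.pow_const _) (fun n => ?_) ?_ ?_
    · filter_upwards [hC n] with x hx
      gcongr
      rw [← ofReal_norm]
      exact ENNReal.ofReal_le_ofReal hx
    · rw [lintegral_const]
      exact ENNReal.mul_ne_top (by simp) (measure_ne_top _ _)
    · filter_upwards [h] with x hx
      have := (ENNReal.continuous_rpow_const (y := (2 : ℝ))).tendsto 0 |>.comp
        (by simpa using hx.enorm : Tendsto (fun n => ‖f n x‖ₑ) atTop (𝓝 0))
      simpa [Function.comp_def] using this
  rw [lintegral_zero] at key
  have := (ENNReal.continuous_rpow_const (y := (1 / 2 : ℝ))).tendsto 0 |>.comp key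
  simpa [Function.comp_def] using this

theorem norm_prodFn_le {f : Fin d → ℝ → ℝ} {C : ℝ} (hC : ∀ j t, |f j t| ≤ C)
    (x : EuclideanSpace ℝ (Fin d)) : ‖prodFn f x‖ ≤ C ^ d := by
  rw [prodFn, Complex.norm_real, Real.norm_eq_abs, Finset.abs_prod]
  calc ∏ j, |f j (x j)| ≤ ∏ _j : Fin d, C :=
        Finset.prod_le_prod (fun _ _ => abs_nonneg _) fun _ _ => hC _ _
    _ = C ^ d := by rw [Finset.prod_const, Finset.card_univ, Fintype.card_fin]

theorem isTestFunction_prodFn {L L' : ℝ} (hL : L' < L) {f : Fin d → ℝ → ℝ}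
    (hf : ∀ j, ContDiff ℝ ∞ (f j))
    (h0 : ∀ j t, t ∉ Set.Icc (-(L' / 2)) (L' / 2) → f j t = 0) :
    IsTestFunction (cube d L) (prodFn f) := by
  have hs : Function.support (prodFn f) ⊆ closedCube d L' := by
    intro x hx j
    by_contra hj
    refine hx ?_
    rw [prodFn, Finset.prod_eq_zero (Finset.mem_univ j) (h0 j _ hj), Complex.ofReal_zero]
  refine ⟨prodFn_contDiff hf, HasCompactSupport.of_support_subset_isCompact
    (isCompact_closedCube d L') hs, ?_⟩
  refine (closure_minimal hs (isCompact_closedCube d L').isClosed).trans fun x hx j => ?_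
  have := hx j
  exact ⟨by linarith [this.1], by linarith [this.2]⟩

/-- Products of functions vanishing at the endpoints are in `H^1_0` of the cube. -/
theorem memH10_toLp_prodFn {L : ℝ} {f f' : Fin d → ℝ → ℝ}
    (hf : ∀ j, ContDiff ℝ ∞ (f j)) (hff' : ∀ j t, HasDerivAt (f j) (f' j t) t)
    {C : ℝ} (hC : ∀ j t, |f j t| ≤ C) (hC' : ∀ j t, |f' j t| ≤ C)
    (h1 : ∀ j t, |f j t| ≤ C * |t + L / 2|) (h2 : ∀ j t, |f j t| ≤ C * |L / 2 - t|) (hC0 : 0 ≤ C)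
    (hm : MemLp (prodFn f) 2 (volume.restrict (cube d L))) : MemH10 (cube d L) hm.toLp := by
  have hcont : ∀ j, Continuous (f j) := fun j => (hf j).continuous
  have hcont' : ∀ j, Continuous (f' j) := by
    intro j
    have e : f' j = deriv (f j) := funext fun t => (hff' j t).deriv.symm
    rw [e]
    exact (hf j).continuous_deriv (by simp)
  have hupd : ∀ i, Continuous (prodFn (Function.update f i (f' i))) := by
    intro i
    refine prodFn_continuous fun j => ?_
    by_cases h : j = i
    · subst h; simpa using hcont' j
    · simpa [h] using hcont j
  have hwd : ∀ i, HasWeakDeriv (cube d L) i hm.toLp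
      (memLp_cube_of_continuous (L := L) (hupd i) 2).toLp := fun i =>
    hasWeakDeriv_toLp (prodFn_contDiff hf) (partialDeriv_prodFn hff' i) hm _
  obtain ⟨K, hK0, hK⟩ := exists_bound_mul_cutoffDeriv L
  -- Each factor is cut off separately, so the approximants remain products; `n + 1` keeps the scale
  -- `1 / (n + 1)` meaningful.
  let g : ℕ → Fin d → ℝ → ℝ := fun n j t => f j t * cutoff L (n + 1) t
  let g' : ℕ → Fin d → ℝ → ℝ := fun n j t =>
    f' j t * cutoff L (n + 1) t + f j t * cutoffDeriv L (n + 1) t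
  -- `C` bounds the term with `f'`, and `2 * (C * K)` the term in which the cutoff is
  -- differentiated.
  set B : ℝ := C + 2 * (C * K) with hB
  have hCB : C ≤ B := by have : 0 ≤ 2 * (C * K) := by positivity
                         linarith
  have hfc : ∀ {a : ℝ} (n : ℕ) (t : ℝ), |a| ≤ C → |a * cutoff L (n + 1) t| ≤ C := by
    intro a n t ha
    rw [abs_mul]
    exact (mul_le_of_le_one_right (abs_nonneg _) (abs_cutoff_le _ _ _)).trans ha
  have hg : ∀ n j t, |g n j t| ≤ B := fun n j t => (hfc n t (hC j t)).trans hCB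
  have hg' : ∀ n j t, |g' n j t| ≤ B := fun n j t =>
    (abs_add_le _ _).trans (add_le_add (hfc n t (hC' j t))
      (hK C (f j t) t (n + 1) (h1 j t) (h2 j t) hC0))
  have hgd : ∀ n j t, HasDerivAt (g n j) (g' n j t) t := fun n j t =>
    (hff' j t).mul (hasDerivAt_cutoff L (n + 1) t)
  have hgs : ∀ n j, ContDiff ℝ ∞ (g n j) := fun n j => (hf j).mul (contDiff_cutoff L (n + 1))
  have htest : ∀ n, IsTestFunction (cube d L) (prodFn (g n)) := by
    intro n
    have hpos : (0 : ℝ) < 2 / ((n + 1 : ℕ) : ℝ) := by positivity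
    refine isTestFunction_prodFn (L' := L - 2 / ((n + 1 : ℕ) : ℝ)) (by linarith) (hgs n)
      fun j t ht => ?_
    change f j t * cutoff L (n + 1) t = 0
    rw [cutoff_eq_zero L (Nat.succ_pos n) ht, mul_zero]
  -- At a fixed point of the open cube the approximation is eventually exact; dominated convergence
  -- then gives `L²` convergence.
  have hev : ∀ x ∈ cube d L, ∀ᶠ n in atTop, ∀ j, g n j (x j) = f j (x j)
      ∧ g' n j (x j) = f' j (x j) := by
    intro x hx
    rw [eventually_all]
    intro j
    have h := (tendsto_add_atTop_nat 1).eventually (eventually_cutoff_eq L (hx j).1 (hx j).2)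
    filter_upwards [h] with n hn
    simp only [g, g', hn.1, hn.2, mul_one, mul_zero, add_zero, and_self]
  have hupdB : ∀ (n : ℕ) (i j : Fin d) (t : ℝ),
      |Function.update (g n) i (g' n i) j t| ≤ B := by
    intro n i j t
    by_cases h : j = i
    · subst h; simpa using hg' n j t
    · simpa [h] using hg n j t
  have hupdB' : ∀ (i j : Fin d) (t : ℝ), |Function.update f i (f' i) j t| ≤ B := by
    intro i j t
    by_cases h : j = i
    · subst h; simpa using (hC' j t).trans hCB
    · simpa [h] using (hC j t).trans hCB
  refine ⟨fun i => ⟨_, trivial, hwd i⟩, fun n => prodFn (g n), htest, ?_, fun i => ?_⟩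
  · refine tendsto_eLpNorm_two_of_dominated (C := B ^ d + B ^ d)
      (fun n => ((Lp.memLp _).sub (htest n).memLp).aestronglyMeasurable) (fun n => ?_) ?_
    · filter_upwards [hm.coeFn_toLp] with x hx
      rw [hx]
      exact (norm_sub_le _ _).trans (add_le_add
        (norm_prodFn_le (fun j t => (hC j t).trans hCB) x) (norm_prodFn_le (hg n) x))
    · have hmem := ae_restrict_mem (μ := volume) (isOpen_cube d L).measurableSet
      filter_upwards [hm.coeFn_toLp, hmem] with x hx hxc
      refine tendsto_const_nhds.congr' ?_
      filter_upwards [hev x hxc] with n hn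
      rw [hx, prodFn, prodFn, Finset.prod_congr rfl fun j _ => (hn j).1, sub_self]
  · rw [(hwd i).weakDeriv_eq (isOpen_cube d L)]
    refine tendsto_eLpNorm_two_of_dominated (C := B ^ d + B ^ d)
      (fun n => ((Lp.memLp _).sub ((htest n).partialDeriv_memLp i)).aestronglyMeasurable)
      (fun n => ?_) ?_
    · filter_upwards [(memLp_cube_of_continuous (L := L) (hupd i) 2).coeFn_toLp] with x hx
      rw [hx, partialDeriv_prodFn (hgd n)]
      exact (norm_sub_le _ _).trans (add_le_add
        (norm_prodFn_le (hupdB' i) x) (norm_prodFn_le (hupdB n i) x))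
    · have hmem := ae_restrict_mem (μ := volume) (isOpen_cube d L).measurableSet
      filter_upwards [(memLp_cube_of_continuous (L := L) (hupd i) 2).coeFn_toLp, hmem] with x hx hxc
      refine tendsto_const_nhds.congr' ?_
      filter_upwards [hev x hxc] with n hn
      rw [hx, partialDeriv_prodFn (hgd n), prodFn_update_mul, prodFn_update_mul, (hn i).2,
        Finset.prod_congr rfl fun j _ => (hn j).1, sub_self]

theorem memH10_mode {L : ℝ} (hL : 0 < L) (k : Fin d → ℕ) :
    MemH10 (cube d L) (mode L (fun _ => false) k) := by
  set q : Fin d → ℝ := fun j => ((k j + 1 : ℕ) : ℝ) * Real.pi / L with hq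
  have hq0 : ∀ j, 0 ≤ q j := fun j => by positivity
  -- `Q` dominates `1` and every `q j`, so the single constant `Q * √(2 / L)` bounds values,
  -- derivatives and slopes at the endpoints.
  set Q : ℝ := 1 + ∑ j, q j with hQ
  have hsum : 0 ≤ ∑ j, q j := Finset.sum_nonneg fun j _ => hq0 j
  have hqQ : ∀ j, q j ≤ Q := fun j => by
    have := Finset.single_le_sum (fun j _ => hq0 j) (Finset.mem_univ j)
    linarith
  have hs0 := Real.sqrt_nonneg (2 / L)
  have hQ1 : 1 ≤ Q := by linarith
  refine memH10_toLp_prodFn (f := fun j => trig L false (k j + 1)) (C := Q * √(2 / L))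
    (fun j => contDiff_trig _ _ _) (fun j t => hasDerivAt_trig _ _ _ _) (fun j t => ?_)
    (fun j t => ?_) (fun j t => ?_) (fun j t => ?_) (by positivity) _
  · exact (abs_trig_le _ _ _ _).trans (le_mul_of_one_le_left hs0 hQ1)
  · rw [abs_mul]
    refine mul_le_mul ?_ (abs_trig_le _ _ _ _) (abs_nonneg _) (by positivity)
    rw [trigFactor, cond_false, abs_of_nonneg (hq0 j)]
    exact hqQ j
  · rw [trig, cond_false, abs_mul, abs_of_nonneg hs0]
    calc √(2 / L) * |Real.sin (q j * (t + L / 2))| ≤ √(2 / L) * |q j * (t + L / 2)| := by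
          exact mul_le_mul_of_nonneg_left Real.abs_sin_le_abs hs0
      _ = q j * √(2 / L) * |t + L / 2| := by rw [abs_mul, abs_of_nonneg (hq0 j)]; ring
      _ ≤ _ := by gcongr; exact hqQ j
  · rw [trig, cond_false, abs_mul, abs_of_nonneg hs0]
    -- Reflection at the right endpoint: an integer frequency makes the sine vanish there too.
    have e : Real.sin (q j * (t + L / 2))
        = -((-1) ^ (k j + 1) * Real.sin (q j * (L / 2 - t))) := by
      have : q j * (t + L / 2) = ((k j + 1 : ℕ) : ℝ) * Real.pi - q j * (L / 2 - t) := by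
        rw [hq]
        field_simp
        ring
      rw [this, Real.sin_nat_mul_pi_sub]
    calc √(2 / L) * |Real.sin (q j * (t + L / 2))|
        = √(2 / L) * |Real.sin (q j * (L / 2 - t))| := by
          rw [e, abs_neg, abs_mul, abs_pow, abs_neg, abs_one, one_pow, one_mul]
      _ ≤ √(2 / L) * |q j * (L / 2 - t)| := by
          exact mul_le_mul_of_nonneg_left Real.abs_sin_le_abs hs0
      _ = q j * √(2 / L) * |L / 2 - t| := by rw [abs_mul, abs_of_nonneg (hq0 j)]; ring
      _ ≤ _ := by gcongr; exact hqQ j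

end SobolevZero

/-! ### Completeness of the sine products -/

section Completeness

variable {d : ℕ}

theorem modeFn_eq_zero {L : ℝ} {k : Fin d → ℕ} {i : Fin d} (hi : k i = 0)
    (x : EuclideanSpace ℝ (Fin d)) : modeFn L (fun _ => false) k x = 0 := by
  rw [modeFn, prodFn, Finset.prod_eq_zero (Finset.mem_univ i), Complex.ofReal_zero]
  simp [hi, trig]

/-- The function `x ↦ cos (π/L (x_i + L/2))`. -/
noncomputable def cosCoord (L : ℝ) (i : Fin d) : C(EuclideanSpace ℝ (Fin d), ℝ) :=
  ⟨fun x => Real.cos (Real.pi / L * (x i + L / 2)), by fun_prop⟩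

/-- Multiplication by the basic cosine keeps the span of the sines invariant, hence also their
orthogonal complement. -/
theorem cos_mul_trig (L : ℝ) (k : ℕ) (t : ℝ) :
    Real.cos (Real.pi / L * (t + L / 2)) * trig L false (k + 1) t
      = (trig L false (k + 2) t + trig L false k t) / 2 := by
  simp only [trig, cond_false]
  set s := Real.pi / L * (t + L / 2) with hs
  have e1 : ((k + 1 : ℕ) : ℝ) * Real.pi / L * (t + L / 2) = k * s + s := by
    rw [hs]; push_cast; ring
  have e2 : ((k + 2 : ℕ) : ℝ) * Real.pi / L * (t + L / 2) = (k * s + s) + s := by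
    rw [hs]; push_cast; ring
  have e3 : (k : ℝ) * Real.pi / L * (t + L / 2) = (k * s + s) - s := by
    rw [hs]; ring
  rw [e1, e2, e3, Real.sin_add (k * s + s), Real.sin_sub]
  ring

theorem modeFn_update (L : ℝ) (k : Fin d → ℕ) (i : Fin d) (m : ℕ)
    (x : EuclideanSpace ℝ (Fin d)) :
    modeFn L (fun _ => false) (Function.update k i m) x
      = ((trig L false m (x i) * ∏ j ∈ Finset.univ.erase i, trig L false (k j) (x j) : ℝ) : ℂ) := by
  rw [← prodFn_update_mul (fun j => trig L false (k j)), modeFn]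
  congr 2
  funext j
  by_cases h : j = i
  · subst h; simp
  · simp [h]

theorem modeFn_mul_cosCoord (L : ℝ) (k : Fin d → ℕ) (i : Fin d) (m : ℕ) (hm : k i = m + 1)
    (x : EuclideanSpace ℝ (Fin d)) :
    modeFn L (fun _ => false) k x * (cosCoord L i x : ℂ)
      = (1 / 2 : ℂ) * (modeFn L (fun _ => false) (Function.update k i (m + 2)) x
        + modeFn L (fun _ => false) (Function.update k i m) x) := by
  have e : modeFn L (fun _ => false) k x
      = modeFn L (fun _ => false) (Function.update k i (m + 1)) x := by
    rw [← hm, Function.update_eq_self]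
  have h := cos_mul_trig L m (x i)
  rw [e, modeFn_update, modeFn_update, modeFn_update, ← Complex.ofReal_mul, ← Complex.ofReal_add]
  have h2 : (1 / 2 : ℂ) = ((1 / 2 : ℝ) : ℂ) := by push_cast; rfl
  rw [h2, ← Complex.ofReal_mul]
  congr 1
  change _ * Real.cos (Real.pi / L * (x i + L / 2)) = _
  linear_combination (∏ j ∈ Finset.univ.erase i, trig L false (k j) (x j)) * h

theorem integrable_mul_L2_of_continuous {L : ℝ} {f : EuclideanSpace ℝ (Fin d) → ℂ}
    (hf : Continuous f) (u : L2 (cube d L)) :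
    Integrable (fun x => f x * u x) (volume.restrict (cube d L)) :=
  integrable_mul_L2 (memLp_cube_of_continuous hf 2) u

theorem integral_modeFn_mul_eq_zero_of_mem_adjoin {L : ℝ} {u : L2 (cube d L)}
    (hu : ∀ k : Fin d → ℕ, ∫ x in cube d L, modeFn L (fun _ => false) k x * u x = 0)
    {g : C(EuclideanSpace ℝ (Fin d), ℝ)} (hg : g ∈ Algebra.adjoin ℝ (Set.range (cosCoord L))) :
    ∀ k : Fin d → ℕ,
      ∫ x in cube d L, modeFn L (fun _ => false) k x * (g x : ℂ) * u x = 0 := by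
  have hmc : ∀ k, Continuous (modeFn (d := d) L (fun _ => false) k) := fun k =>
    (contDiff_modeFn L _ k).continuous
  have hgc : ∀ h : C(EuclideanSpace ℝ (Fin d), ℝ), Continuous fun x => ((h x : ℝ) : ℂ) := fun h =>
    Complex.continuous_ofReal.comp h.continuous
  have hint : ∀ (k : Fin d → ℕ) (h : C(EuclideanSpace ℝ (Fin d), ℝ)),
      Integrable (fun x => modeFn L (fun _ => false) k x * (h x : ℂ) * u x)
        (volume.restrict (cube d L)) := fun k h =>
    integrable_mul_L2_of_continuous ((hmc k).mul (hgc h)) u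
  -- Orthogonality is carried along with an extra factor `h`, so that the induction closes under
  -- products; `h = 1` gives the claim.
  suffices H : ∀ h : C(EuclideanSpace ℝ (Fin d), ℝ),
      (∀ k : Fin d → ℕ, ∫ x in cube d L, modeFn L (fun _ => false) k x * (h x : ℂ) * u x = 0) →
      ∀ k : Fin d → ℕ,
        ∫ x in cube d L, modeFn L (fun _ => false) k x * ((g * h) x : ℂ) * u x = 0 by
    simpa using H 1 (by simpa using hu)
  induction hg using Algebra.adjoin_induction with
  | mem g hg =>
    obtain ⟨i, rfl⟩ := hg
    intro h hh k
    rcases hk : k i with _ | m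
    · simp [modeFn_eq_zero hk]
    · have e : ∀ x, modeFn L (fun _ => false) k x * ((cosCoord L i * h) x : ℂ) * u x
          = (1 / 2 : ℂ) * (modeFn L (fun _ => false) (Function.update k i (m + 2)) x * (h x : ℂ) * u x
            + modeFn L (fun _ => false) (Function.update k i m) x * (h x : ℂ) * u x) := by
        intro x
        rw [ContinuousMap.mul_apply, Complex.ofReal_mul, ← mul_assoc,
          modeFn_mul_cosCoord L k i m hk]
        ring
      simp only [e]
      rw [integral_const_mul, integral_add (hint _ h) (hint _ h), hh, hh]
      simp
  | algebraMap r =>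
    intro h hh k
    have e : ∀ x, modeFn L (fun _ => false) k x
        * (((algebraMap ℝ C(EuclideanSpace ℝ (Fin d), ℝ) r * h) x : ℝ) : ℂ) * u x
        = (r : ℂ) * (modeFn L (fun _ => false) k x * (h x : ℂ) * u x) := by
      intro x
      rw [ContinuousMap.mul_apply, Complex.ofReal_mul]
      have hr : algebraMap ℝ C(EuclideanSpace ℝ (Fin d), ℝ) r x = r := by
        simp [Algebra.algebraMap_eq_smul_one]
      rw [hr]
      ring
    simp only [e]
    rw [integral_const_mul, hh, mul_zero]
  | add f g _ _ hf hg =>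
    intro h hh k
    have e : ∀ x, modeFn L (fun _ => false) k x * (((f + g) * h) x : ℂ) * u x
        = modeFn L (fun _ => false) k x * ((f * h) x : ℂ) * u x
          + modeFn L (fun _ => false) k x * ((g * h) x : ℂ) * u x := by
      intro x
      simp only [ContinuousMap.mul_apply, ContinuousMap.add_apply, Complex.ofReal_mul,
        Complex.ofReal_add]
      ring
    simp only [e]
    rw [integral_add (hint k (f * h)) (hint k (g * h)), hf h hh, hg h hh, add_zero]
  | mul f g _ _ hf hg =>
    intro h hh k
    rw [mul_assoc]
    exact hf (g * h) (hg h hh) k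

/-- Stone–Weierstrass: on the closed cube each cosine argument ranges over `[0, π]`, where the
cosine is injective, so the `cosCoord L i` separate points. -/
theorem exists_mem_adjoin_cosCoord_near {L : ℝ} (hL : 0 < L)
    (φ : EuclideanSpace ℝ (Fin d) → ℝ) (hφ : Continuous φ) {ε : ℝ} (hε : 0 < ε) :
    ∃ g ∈ Algebra.adjoin ℝ (Set.range (cosCoord (d := d) L)),
      ∀ x ∈ closedCube d L, |g x - φ x| < ε := by
  have : CompactSpace (closedCube d L) := isCompact_iff_compactSpace.1 (isCompact_closedCube d L)
  let r : C(EuclideanSpace ℝ (Fin d), ℝ) →ₐ[ℝ] C(closedCube d L, ℝ) :=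
    ContinuousMap.compRightAlgHom ℝ ℝ ⟨Subtype.val, continuous_subtype_val⟩
  have hsep : ((Algebra.adjoin ℝ (Set.range (cosCoord (d := d) L))).map r).SeparatesPoints := by
    intro x y hxy
    have hne : ∃ i, (x : EuclideanSpace ℝ (Fin d)) i ≠ (y : EuclideanSpace ℝ (Fin d)) i := by
      by_contra! h
      exact hxy (Subtype.ext (PiLp.ext h))
    obtain ⟨i, hi⟩ := hne
    refine ⟨_, ⟨r (cosCoord L i), ⟨cosCoord L i, Algebra.subset_adjoin ⟨i, rfl⟩, rfl⟩, rfl⟩, ?_⟩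
    change Real.cos (Real.pi / L * ((x : EuclideanSpace ℝ (Fin d)) i + L / 2))
      ≠ Real.cos (Real.pi / L * ((y : EuclideanSpace ℝ (Fin d)) i + L / 2))
    have hmem : ∀ z : closedCube d L, Real.pi / L * ((z : EuclideanSpace ℝ (Fin d)) i + L / 2)
        ∈ Set.Icc 0 Real.pi := by
      intro z
      have hz := z.2 i
      have hpos : 0 < Real.pi / L := by positivity
      refine ⟨mul_nonneg hpos.le (by linarith [hz.1]), ?_⟩
      calc Real.pi / L * ((z : EuclideanSpace ℝ (Fin d)) i + L / 2) ≤ Real.pi / L * L := by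
            gcongr
            linarith [hz.2]
        _ = Real.pi := by field_simp
    intro h
    have h1 := Real.injOn_cos (hmem x) (hmem y) h
    have hpos : Real.pi / L ≠ 0 := by positivity
    exact hi (add_right_cancel (mul_left_cancel₀ hpos h1))
  obtain ⟨⟨g, hg⟩, hgφ⟩ := ContinuousMap.exists_mem_subalgebra_near_continuous_of_separatesPoints
    _ hsep (fun x => φ x) (hφ.comp continuous_subtype_val) ε hε
  obtain ⟨g₀, hg₀, rfl⟩ := hg
  exact ⟨g₀, hg₀, fun x hx => hgφ ⟨x, hx⟩⟩

theorem modeFn_one_ne_zero {L : ℝ} (hL : 0 < L) {x : EuclideanSpace ℝ (Fin d)}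
    (hx : x ∈ cube d L) : modeFn L (fun _ => false) (fun _ => 1) x ≠ 0 := by
  rw [modeFn, prodFn, Complex.ofReal_ne_zero]
  refine (Finset.prod_pos fun j _ => ?_).ne'
  rw [trig, cond_false]
  refine mul_pos (by positivity) (Real.sin_pos_of_pos_of_lt_pi ?_ ?_)
  · have : 0 < x j + L / 2 := by linarith [(hx j).1]
    positivity
  · have h2 : x j + L / 2 < L := by linarith [(hx j).2]
    calc ((1 : ℕ) : ℝ) * Real.pi / L * (x j + L / 2) < ((1 : ℕ) : ℝ) * Real.pi / L * L := by
          gcongr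
      _ = Real.pi := by field_simp; simp

/-- With `w` the lowest mode, `w * u` annihilates all polynomials in the cosines, hence by density
all test functions. So `w * u = 0`, and `w` has no zero in the open cube. -/
theorem eq_zero_of_forall_integral_modeFn {L : ℝ} (hL : 0 < L) {u : L2 (cube d L)}
    (hu : ∀ k : Fin d → ℕ, ∫ x in cube d L, modeFn L (fun _ => false) k x * u x = 0) : u = 0 := by
  set w := modeFn (d := d) L (fun _ => false) (fun _ => 1) with hw
  have hwc : Continuous w := (contDiff_modeFn L _ _).continuous
  have hint := integrable_mul_L2_of_continuous hwc u
  have hae := (isOpen_cube d L).ae_eq_zero_of_integral_contDiff_smul_eq_zero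
    (f := fun x => w x * u x) (μ := volume) (IntegrableOn.locallyIntegrableOn hint) (by
    intro φ hφ hφc hφs
    rw [← setIntegral_eq_integral_of_forall_compl_eq_zero (s := cube d L)]
    swap
    · intro x hx
      have : φ x = 0 := by
        by_contra hne
        exact hx (hφs (subset_tsupport _ hne))
      simp [this]
    rw [← norm_le_zero_iff]
    refine le_of_forall_pos_le_add fun ε hε => ?_
    set N := ∫ x in cube d L, ‖w x * u x‖ with hN
    have hN0 : 0 ≤ N := integral_nonneg fun _ => norm_nonneg _
    obtain ⟨g, hg, hgφ⟩ := exists_mem_adjoin_cosCoord_near hL φ hφ.continuous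
      (ε := ε / (N + 1)) (by positivity)
    have h0 := integral_modeFn_mul_eq_zero_of_mem_adjoin hu hg (fun _ => 1)
    have hφi : Integrable (fun x => φ x • (w x * u x)) (volume.restrict (cube d L)) := by
      have := integrable_mul_L2_of_continuous
        ((Complex.continuous_ofReal.comp hφ.continuous).mul hwc) u
      refine this.congr (Eventually.of_forall fun x => ?_)
      simp [mul_assoc]
    have hgi : Integrable (fun x => w x * (g x : ℂ) * u x) (volume.restrict (cube d L)) :=
      integrable_mul_L2_of_continuous (hwc.mul (Complex.continuous_ofReal.comp g.continuous)) u
    have e : ∫ x in cube d L, φ x • (w x * u x)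
        = ∫ x in cube d L, (((φ x - g x : ℝ) : ℂ) * (w x * u x)) := by
      rw [← sub_zero (∫ x in cube d L, φ x • (w x * u x)), ← h0, ← integral_sub hφi hgi]
      refine integral_congr_ae (Eventually.of_forall fun x => ?_)
      simp only [Complex.real_smul, Complex.ofReal_sub]
      ring
    rw [e, zero_add]
    calc ‖∫ x in cube d L, (((φ x - g x : ℝ) : ℂ) * (w x * u x))‖
        ≤ ∫ x in cube d L, ε / (N + 1) * ‖w x * u x‖ := by
          refine norm_integral_le_of_norm_le (hint.norm.const_mul _) ?_
          refine (ae_restrict_iff' (isOpen_cube d L).measurableSet).2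
            (Eventually.of_forall fun x hx => ?_)
          rw [norm_mul, Complex.norm_real, Real.norm_eq_abs, abs_sub_comm]
          gcongr
          exact (hgφ x (cube_subset_closedCube d L hx)).le
      _ = ε * (N / (N + 1)) := by rw [integral_const_mul, ← hN]; ring
      _ ≤ ε := mul_le_of_le_one_right hε.le (div_le_one_of_le₀ (by linarith) (by linarith)))
  refine Lp.ext ?_
  have h1 : ∀ᵐ x ∂(volume.restrict (cube d L)), w x * u x = 0 :=
    (ae_restrict_iff' (isOpen_cube d L).measurableSet).2 hae
  filter_upwards [h1, Lp.coeFn_zero ℂ 2 (volume.restrict (cube d L)),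
    ae_restrict_mem (μ := volume) (isOpen_cube d L).measurableSet] with x hx hx0 hxc
  rw [hx0]
  exact (mul_eq_zero.1 hx).resolve_left (modeFn_one_ne_zero hL hxc)

theorem orthogonal_span_mode {L : ℝ} (hL : 0 < L) :
    (Submodule.span ℂ (Set.range (mode L (fun _ => false) : (Fin d → ℕ) → L2 (cube d L))))ᗮ = ⊥ := by
  rw [eq_bot_iff]
  intro u hu
  refine eq_zero_of_forall_integral_modeFn hL fun k => ?_
  -- A mode with a zero frequency vanishes; every other one is a basis function with its index
  -- lowered by one.
  by_cases h : ∃ i, k i = 0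
  · obtain ⟨i, hi⟩ := h
    simp [modeFn_eq_zero hi]
  · push Not at h
    have := (Submodule.mem_orthogonal _ _).1 hu _ (Submodule.subset_span ⟨fun j => k j - 1, rfl⟩)
    rw [inner_mode] at this
    have e : (fun j => k j - 1 + 1) = k := funext fun j =>
      Nat.sub_add_cancel (Nat.one_le_iff_ne_zero.2 (h j))
    rwa [e] at this

/-- The Hilbert basis of sine products. -/
noncomputable def sineBasis (d : ℕ) {L : ℝ} (hL : 0 < L) :
    HilbertBasis (Fin d → ℕ) ℂ (L2 (cube d L)) :=
  HilbertBasis.mkOfOrthogonalEqBot (orthonormal_mode hL fun _ => false) (orthogonal_span_mode hL)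

theorem sineBasis_apply {L : ℝ} (hL : 0 < L) (k : Fin d → ℕ) :
    sineBasis d hL k = mode L (fun _ => false) k :=
  congrFun (HilbertBasis.coe_mkOfOrthogonalEqBot _ _) k

end Completeness

/-! ### Closedness of `H^1_0` -/

section Closedness

variable {d : ℕ} {Ω : Set (EuclideanSpace ℝ (Fin d))}

theorem pairing_smul_left (c : ℂ) (a u : L2 Ω) : pairing (c • a) u = c * pairing a u := by
  rw [pairing_comm, pairing_comm a]
  exact inner_smul_right _ _ _

theorem pairing_smul_right (c : ℂ) (a u : L2 Ω) : pairing a (c • u) = c * pairing a u :=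
  inner_smul_right _ _ _

theorem hasWeakDeriv_weakDeriv (hΩ : IsOpen Ω) {k : ℕ} {u : L2 Ω} (hu : u ∈ sobolev Ω (k + 1))
    (i : Fin d) : HasWeakDeriv Ω i u (weakDeriv Ω i u) := by
  obtain ⟨g, _, h⟩ := exists_hasWeakDeriv hu i
  rwa [h.weakDeriv_eq hΩ]

/-- The classes of the test functions together with their gradients. -/
def testGraph (Ω : Set (EuclideanSpace ℝ (Fin d))) : Set (L2 Ω × (Fin d → L2 Ω)) :=
  {z | ∃ (φ : EuclideanSpace ℝ (Fin d) → ℂ) (hφ : IsTestFunction Ω φ),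
    z = (hφ.memLp.toLp, fun i => (hφ.partialDeriv_memLp i).toLp)}

theorem eLpNorm_tendsto_of_toLp {μ : Measure (EuclideanSpace ℝ (Fin d))}
    {w : Lp ℂ 2 μ} {φ : ℕ → EuclideanSpace ℝ (Fin d) → ℂ}
    (hφ : ∀ n, MemLp (φ n) 2 μ) (h : Tendsto (fun n => (hφ n).toLp) atTop (𝓝 w)) :
    Tendsto (fun n => eLpNorm (fun x => w x - φ n x) 2 μ) atTop (𝓝 0) := by
  rw [Lp.tendsto_Lp_iff_tendsto_eLpNorm'] at h
  refine h.congr fun n => ?_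
  rw [eLpNorm_congr_ae (((hφ n).coeFn_toLp).sub (EventuallyEq.refl _ _)), eLpNorm_sub_comm]
  rfl

theorem memH10_iff {u : L2 Ω} : MemH10 Ω u ↔
    u ∈ sobolev Ω 1 ∧ (u, fun i => weakDeriv Ω i u) ∈ closure (testGraph Ω) := by
  refine and_congr_right fun _ => ?_
  rw [mem_closure_iff_seq_limit]
  constructor
  · rintro ⟨φ, hφ, h0, h1⟩
    refine ⟨_, fun n => ⟨φ n, hφ n, rfl⟩, Tendsto.prodMk_nhds ?_ (tendsto_pi_nhds.2 fun i => ?_)⟩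
    · exact tendsto_toLp_of_eLpNorm (fun n => (hφ n).memLp) h0
    · exact tendsto_toLp_of_eLpNorm (fun n => (hφ n).partialDeriv_memLp i) (h1 i)
  · rintro ⟨z, hz, hlim⟩
    choose φ hφ hzφ using hz
    have hlim' := hlim.congr hzφ
    rw [Prod.tendsto_iff] at hlim'
    exact ⟨φ, hφ, eLpNorm_tendsto_of_toLp (fun n => (hφ n).memLp) hlim'.1, fun i =>
      eLpNorm_tendsto_of_toLp (fun n => (hφ n).partialDeriv_memLp i)
        (tendsto_pi_nhds.1 hlim'.2 i)⟩

/-- Closedness of the weak derivative identifies the limits `g₀` as derivatives of `u₀`; the closure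
of the test graph then contains the limit. This admits infinite sine series to `H^1_0`. -/
theorem MemH10.of_tendsto (hΩ : IsOpen Ω) {ι : Type*} {l : Filter ι} [l.NeBot] {u : ι → L2 Ω}
    {u₀ : L2 Ω} {g₀ : Fin d → L2 Ω} (hu : ∀ n, MemH10 Ω (u n)) (hlim : Tendsto u l (𝓝 u₀))
    (hg : ∀ i, Tendsto (fun n => weakDeriv Ω i (u n)) l (𝓝 (g₀ i))) : MemH10 Ω u₀ := by
  have hwd : ∀ i, HasWeakDeriv Ω i u₀ (g₀ i) := fun i =>
    HasWeakDeriv.of_tendsto (fun n => hasWeakDeriv_weakDeriv hΩ (hu n).1 i) hlim (hg i)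
  refine memH10_iff.2 ⟨fun i => ⟨_, trivial, hwd i⟩, ?_⟩
  have e : (fun i => weakDeriv Ω i u₀) = g₀ := funext fun i => (hwd i).weakDeriv_eq hΩ
  rw [e]
  exact isClosed_closure.mem_of_tendsto (hlim.prodMk_nhds (tendsto_pi_nhds.2 hg))
    (Eventually.of_forall fun n => (memH10_iff.1 (hu n)).2)

theorem Orthonormal.summable_smul {ι H : Type*} [NormedAddCommGroup H] [InnerProductSpace ℂ H]
    [CompleteSpace H] {v : ι → H} (hv : Orthonormal ℂ v) {c : ι → ℂ}
    (hc : Summable fun n => ‖c n‖ ^ 2) : Summable fun n => c n • v n := by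
  have := (hv.orthogonalFamily.summable_iff_norm_sq_summable c).2 hc
  simpa using this

end Closedness

/-! ### The Dirichlet Laplacian in the sine basis -/

section Regularity

variable {d : ℕ}

/-- The eigenvalues of the Dirichlet Laplacian on the cube. -/
noncomputable def dirichletEigenvalue (L : ℝ) (k : Fin d → ℕ) : ℝ :=
  ∑ j, (((k j + 1 : ℕ) : ℝ) * Real.pi / L) ^ 2

theorem trigFactor_sq (L : ℝ) (p : Bool) (m : ℕ) :
    trigFactor L p m ^ 2 = ((m : ℝ) * Real.pi / L) ^ 2 := by
  cases p <;> simp [trigFactor]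

theorem trigFactor_sq_le (L : ℝ) (p : Bool) (k : Fin d → ℕ) (j : Fin d) :
    trigFactor L p (k j + 1) ^ 2 ≤ dirichletEigenvalue L k := by
  rw [trigFactor_sq]
  exact Finset.single_le_sum (f := fun j => (((k j + 1 : ℕ) : ℝ) * Real.pi / L) ^ 2)
    (fun j _ => sq_nonneg _) (Finset.mem_univ j)

theorem dirichletEigenvalue_nonneg (L : ℝ) (k : Fin d → ℕ) : 0 ≤ dirichletEigenvalue L k :=
  Finset.sum_nonneg fun _ _ => sq_nonneg _

theorem inner_mode_eq_pairing (L : ℝ) (p : Fin d → Bool) (k : Fin d → ℕ) (u : L2 (cube d L)) :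
    inner ℂ (mode L p k) u = pairing (mode L p k) u := by
  rw [inner_mode, mode, pairing_toLp_eq_integral]

/-- Two integrations by parts. The first is justified by the sine product lying in `H^1_0`; it
leaves a mode with a cosine factor, so the second must rely on `u` lying in `H^1_0`. -/
theorem inner_mode_weakDeriv_weakDeriv {L : ℝ} (hL : 0 < L) {u : L2 (cube d L)}
    (hu : MemH10 (cube d L) u) (hu2 : u ∈ sobolev (cube d L) 2) (k : Fin d → ℕ) (i : Fin d) :
    inner ℂ (mode L (fun _ => false) k) (weakDeriv (cube d L) i (weakDeriv (cube d L) i u))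
      = -((((k i + 1 : ℕ) : ℝ) * Real.pi / L) ^ 2 : ℝ)
        * inner ℂ (mode L (fun _ => false) k) u := by
  have hΩ := isOpen_cube d L
  set p : Fin d → Bool := fun _ => false with hp
  set q : Fin d → Bool := Function.update p i (!p i) with hq
  have hqi : q i = true := by simp [hq, hp]
  have hqp : Function.update q i (!q i) = p := by
    rw [hqi, hq, Function.update_idem]
    exact Function.update_eq_self _ _
  have h1 := hasWeakDeriv_mode L p k i
  have h2 := hasWeakDeriv_mode L q k i
  rw [hqp, hqi] at h2
  rw [← hq] at h1
  have e1 := (memH10_mode hL k).pairing_eq (hasWeakDeriv_weakDeriv hΩ (weakDeriv_mem hΩ hu2 i) i)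
  have e2 := hu.pairing_eq h2
  rw [← hp, h1.weakDeriv_eq hΩ, pairing_smul_left] at e1
  rw [pairing_smul_right, pairing_comm, pairing_comm _ (mode L q k)] at e2
  rw [inner_mode_eq_pairing, inner_mode_eq_pairing, e1]
  have e3 : pairing (mode L q k) (weakDeriv (cube d L) i u)
      = -((trigFactor L true (k i + 1) : ℂ) * pairing (mode L p k) u) := by
    rw [e2, neg_neg]
  rw [e3]
  simp only [trigFactor, cond_true, hp, cond_false]
  push_cast
  ring

/-- Elliptic regularity on the cube, by expansion in sine products. -/
theorem mem_domain_of_coeff {L : ℝ} (hL : 0 < L) {u f : L2 (cube d L)}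
    (h : ∀ k, (dirichletEigenvalue L k : ℂ) * inner ℂ (mode L (fun _ => false) k) u
      = inner ℂ (mode L (fun _ => false) k) f) :
    MemH10 (cube d L) u ∧ u ∈ sobolev (cube d L) 2 := by
  have hΩ := isOpen_cube d L
  set p : Fin d → Bool := fun _ => false with hp
  let q : Fin d → Fin d → Bool := fun i => Function.update p i (!p i)
  let r : Fin d → Fin d → Fin d → Bool := fun i j => Function.update (q i) j (!(q i j))
  let a : (Fin d → ℕ) → ℂ := fun k => inner ℂ (mode L p k) u
  let F : Fin d → (Fin d → ℕ) → ℂ := fun i k => (trigFactor L (p i) (k i + 1) : ℂ)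
  let G : Fin d → Fin d → (Fin d → ℕ) → ℂ := fun i j k => (trigFactor L (q i j) (k j + 1) : ℂ)
  have hF : ∀ i k, ‖F i k‖ ^ 2 ≤ dirichletEigenvalue L k := fun i k => by
    simpa only [F, Complex.norm_real, Real.norm_eq_abs, sq_abs] using trigFactor_sq_le L (p i) k i
  have hG : ∀ i j k, ‖G i j k‖ ^ 2 ≤ dirichletEigenvalue L k := fun i j k => by
    simpa only [G, Complex.norm_real, Real.norm_eq_abs, sq_abs] using trigFactor_sq_le L (q i j) k j
  have hu : HasSum (fun k => a k • mode L p k) u := by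
    have := (sineBasis d hL).hasSum_repr u
    simpa only [HilbertBasis.repr_apply_apply, sineBasis_apply] using this
  have ha : Summable fun k => ‖a k‖ ^ 2 := by
    have := (HilbertBasis.hasSum_norm_sq (sineBasis d hL) u).summable
    simpa only [sineBasis_apply] using this
  -- These are the squared coefficients of `f`.
  have haf : Summable fun k => dirichletEigenvalue L k ^ 2 * ‖a k‖ ^ 2 := by
    have := (HilbertBasis.hasSum_norm_sq (sineBasis d hL) f).summable
    refine this.congr fun k => ?_
    rw [sineBasis_apply, ← h k, norm_mul, Complex.norm_real, mul_pow, Real.norm_eq_abs, sq_abs]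
  have hs1 : ∀ i, Summable fun k => (a k * F i k) • mode L (q i) k := by
    intro i
    refine Orthonormal.summable_smul (orthonormal_mode hL (q i)) ?_
    refine Summable.of_nonneg_of_le (fun _ => by positivity) (fun k => ?_) (ha.add haf)
    rw [norm_mul, mul_pow]
    -- For the eigenvalue `λ` of index `k`, first derivatives carry squared weights at most `λ ≤ 1 +
    -- λ ^ 2`.
    have h1 := mul_le_mul_of_nonneg_left (hF i k) (sq_nonneg ‖a k‖)
    have h2 := mul_nonneg (sq_nonneg ‖a k‖) (sq_nonneg (dirichletEigenvalue L k - 1))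
    have h3 := mul_nonneg (sq_nonneg ‖a k‖) (dirichletEigenvalue_nonneg L k)
    nlinarith
  -- Every second derivative, mixed ones included, has squared weights at most the squared
  -- eigenvalue.
  have hs2 : ∀ i j, Summable fun k => (a k * F i k * G i j k) • mode L (r i j) k := by
    intro i j
    refine Orthonormal.summable_smul (orthonormal_mode hL (r i j)) ?_
    refine Summable.of_nonneg_of_le (fun _ => by positivity) (fun k => ?_) haf
    rw [norm_mul, norm_mul, mul_pow, mul_pow]
    have h1 := mul_le_mul (hF i k) (hG i j k) (by positivity) (dirichletEigenvalue_nonneg L k)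
    have h2 := mul_le_mul_of_nonneg_left h1 (sq_nonneg ‖a k‖)
    calc ‖a k‖ ^ 2 * ‖F i k‖ ^ 2 * ‖G i j k‖ ^ 2
        = ‖a k‖ ^ 2 * (‖F i k‖ ^ 2 * ‖G i j k‖ ^ 2) := by ring
      _ ≤ _ := h2
      _ = _ := by ring
  have hw1 : ∀ i k, HasWeakDeriv (cube d L) i (a k • mode L p k) ((a k * F i k) • mode L (q i) k) := by
    intro i k
    rw [mul_smul]
    exact (hasWeakDeriv_mode L p k i).smul (a k)
  have hw2 : ∀ i j k, HasWeakDeriv (cube d L) j ((a k * F i k) • mode L (q i) k)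
      ((a k * F i k * G i j k) • mode L (r i j) k) := by
    intro i j k
    rw [mul_smul (a k * F i k)]
    exact (hasWeakDeriv_mode L (q i) k j).smul (a k * F i k)
  constructor
  · refine MemH10.of_tendsto hΩ (u := fun s : Finset (Fin d → ℕ) => ∑ k ∈ s, a k • mode L p k)
      (l := atTop) (g₀ := fun i => ∑' k, (a k * F i k) • mode L (q i) k) (fun s => ?_) hu
      (fun i => ?_)
    · exact Submodule.sum_mem (sobolevZero (cube d L) hΩ) fun k _ =>
        Submodule.smul_mem (sobolevZero (cube d L) hΩ) (a k) (memH10_mode hL k)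
    · refine (hs1 i).hasSum.congr fun s => ?_
      exact (HasWeakDeriv.sum s (hw1 i)).weakDeriv_eq hΩ |>.symm
  · intro i
    refine ⟨_, fun j => ?_, HasWeakDeriv.of_hasSum (hw1 i) hu (hs1 i).hasSum⟩
    exact ⟨_, trivial, HasWeakDeriv.of_hasSum (hw2 i j) (hs1 i).hasSum (hs2 i j).hasSum⟩

end Regularity

/-! ### The potential as a bounded nonnegative operator -/

section Potential

variable {d : ℕ} {Ω : Set (EuclideanSpace ℝ (Fin d))} {v : EuclideanSpace ℝ (Fin d) → ℝ}

theorem coeFn_mulPotential (hv : MemLp v ∞ volume) (u : L2 Ω) :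
    mulPotential Ω v hv u =ᵐ[volume.restrict Ω] fun x => (v x : ℂ) * u x :=
  (potential_mul_memLp hv u).coeFn_toLp

theorem norm_mulPotential_le (hv : MemLp v ∞ volume) (u : L2 Ω) :
    ‖mulPotential Ω v hv u‖ ≤ (eLpNorm v ∞ volume).toReal * ‖u‖ := by
  refine Lp.norm_le_mul_norm_of_ae_le_mul ?_
  have h1 : ∀ᵐ x ∂(volume.restrict Ω), ‖v x‖ₑ ≤ eLpNorm v ∞ volume := by
    rw [eLpNorm_exponent_top]
    exact ae_restrict_of_ae ae_le_eLpNormEssSup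
  filter_upwards [coeFn_mulPotential hv u, h1] with x hx hx1
  rw [hx, norm_mul, Complex.norm_real]
  gcongr
  rw [← toReal_enorm]
  exact ENNReal.toReal_mono hv.eLpNorm_ne_top hx1

/-- Multiplication by a bounded potential as a bounded operator. -/
noncomputable def mulPotentialCLM (Ω : Set (EuclideanSpace ℝ (Fin d)))
    (v : EuclideanSpace ℝ (Fin d) → ℝ) (hv : MemLp v ∞ volume) : L2 Ω →L[ℂ] L2 Ω :=
  (mulPotential Ω v hv).mkContinuous _ (norm_mulPotential_le hv)

theorem inner_mulPotential (hv : MemLp v ∞ volume) (u w : L2 Ω) :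
    inner ℂ u (mulPotentialCLM Ω v hv w)
      = ∫ x in Ω, (v x : ℂ) * (w x * (starRingEnd ℂ) (u x)) := by
  rw [L2.inner_def]
  refine integral_congr_ae ?_
  filter_upwards [coeFn_mulPotential hv w] with x hx
  rw [RCLike.inner_apply]
  change mulPotential Ω v hv w x * _ = _
  rw [hx, mul_assoc]

theorem mulPotential_symm (hv : MemLp v ∞ volume) (u w : L2 Ω) :
    inner ℂ (mulPotentialCLM Ω v hv u) w = inner ℂ u (mulPotentialCLM Ω v hv w) := by
  rw [← inner_conj_symm, inner_mulPotential, inner_mulPotential, ← integral_conj]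
  refine integral_congr_ae (Eventually.of_forall fun x => ?_)
  simp only [map_mul, Complex.conj_ofReal, Complex.conj_conj]
  ring

theorem re_inner_mulPotential_nonneg (hv : MemLp v ∞ volume) (hv0 : ∀ᵐ x ∂volume, 0 ≤ v x)
    (u : L2 Ω) : 0 ≤ (inner ℂ u (mulPotentialCLM Ω v hv u)).re := by
  have e : ∀ x, (v x : ℂ) * (u x * (starRingEnd ℂ) (u x)) = ((v x * Complex.normSq (u x) : ℝ) : ℂ) := by
    intro x
    rw [Complex.mul_conj, Complex.ofReal_mul]
  rw [inner_mulPotential]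
  simp only [e]
  rw [integral_complex_ofReal, Complex.ofReal_re]
  refine integral_nonneg_of_ae ?_
  filter_upwards [ae_restrict_of_ae hv0] with x hx
  exact mul_nonneg hx (Complex.normSq_nonneg _)

/-- The potential energy of a bounded function. -/
theorem re_inner_mulPotential_le (hv : MemLp v ∞ volume) (hv1 : MemLp v 1 volume)
    {u : L2 Ω} {B : ℝ} (hB : ∀ᵐ x ∂(volume.restrict Ω), ‖u x‖ ^ 2 ≤ B) (hB0 : 0 ≤ B) :
    (inner ℂ u (mulPotentialCLM Ω v hv u)).re ≤ B * ∫ x, ‖v x‖ := by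
  have hint : Integrable v volume := memLp_one_iff_integrable.1 hv1
  refine (Complex.re_le_norm _).trans ?_
  rw [inner_mulPotential]
  calc ‖∫ x in Ω, (v x : ℂ) * (u x * (starRingEnd ℂ) (u x))‖
      ≤ ∫ x in Ω, B * ‖v x‖ := by
        refine norm_integral_le_of_norm_le (hint.norm.restrict.const_mul B) ?_
        filter_upwards [hB] with x hx
        rw [norm_mul, norm_mul, RCLike.norm_conj, Complex.norm_real, ← sq, mul_comm]
        gcongr
    _ = B * ∫ x in Ω, ‖v x‖ := integral_const_mul _ _
    _ ≤ B * ∫ x, ‖v x‖ := by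
        gcongr
        · exact Eventually.of_forall fun _ => norm_nonneg _
        · exact hint.norm
        · exact Measure.restrict_le_self

end Potential

/-! ### Eigenvalue bounds for the Schrödinger operator -/

section Schrodinger

variable {d : ℕ} {L : ℝ} {v : EuclideanSpace ℝ (Fin d) → ℝ}

theorem schrodinger_apply (hv : MemLp v ∞ volume) (u : (schrodinger d L v hv).domain) :
    schrodinger d L v hv u
      = -(∑ i, weakDeriv (cube d L) i (weakDeriv (cube d L) i (u : L2 (cube d L))))
        + mulPotentialCLM (cube d L) v hv u := rfl

theorem finite_dirichletEigenvalue_le (hL : 0 < L) (t : ℝ) :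
    {k : Fin d → ℕ | dirichletEigenvalue L k ≤ t}.Finite := by
  obtain ⟨N, hN⟩ := exists_nat_ge (t * (L / Real.pi) ^ 2)
  refine (Set.Finite.pi' (t := fun _ : Fin d => Set.Iic N) fun _ => Set.finite_Iic N).subset ?_
  intro k hk j
  have h1 : (((k j + 1 : ℕ) : ℝ) * Real.pi / L) ^ 2 ≤ t := by
    have := trigFactor_sq_le L false k j
    rw [trigFactor_sq] at this
    exact this.trans hk
  have h2 : ((k j + 1 : ℕ) : ℝ) ^ 2 ≤ N := by
    refine le_trans ?_ hN
    have e : ((k j + 1 : ℕ) : ℝ) ^ 2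
        = (((k j + 1 : ℕ) : ℝ) * Real.pi / L) ^ 2 * (L / Real.pi) ^ 2 := by
      field_simp
    rw [e]
    gcongr
  have h3 : (k j + 1) ^ 2 ≤ N := by exact_mod_cast h2
  change k j ≤ N
  nlinarith

theorem dirichletEigenvalue_pos (hL : 0 < L) (hd : 0 < d) (k : Fin d → ℕ) :
    0 < dirichletEigenvalue L k :=
  Finset.sum_pos (fun j _ => by positivity) ⟨⟨0, hd⟩, Finset.mem_univ _⟩

theorem isDiagonalAdd_schrodinger (hL : 0 < L) (hd : 0 < d) (hv0 : ∀ᵐ x ∂volume, 0 ≤ v x)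
    (hv : MemLp v ∞ volume) :
    IsDiagonalAdd (schrodinger d L v hv) (sineBasis d hL) (dirichletEigenvalue L)
      (mulPotentialCLM (cube d L) v hv) where
  pos := dirichletEigenvalue_pos hL hd
  finite := finite_dirichletEigenvalue_le hL
  inner_apply u k := by
    rw [schrodinger_apply, inner_add_right, inner_neg_right, inner_sum, sineBasis_apply,
      Finset.sum_congr rfl fun i _ => inner_mode_weakDeriv_weakDeriv hL u.2.1 u.2.2 k i,
      ← Finset.sum_mul, Finset.sum_neg_distrib, neg_mul, neg_neg, dirichletEigenvalue,
      Complex.ofReal_sum]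
  mem_domain u f h := by
    refine mem_domain_of_coeff (f := f) hL fun k => ?_
    have := h k
    rwa [sineBasis_apply] at this
  symm := mulPotential_symm hv
  nonneg := re_inner_mulPotential_nonneg hv hv0

theorem re_inner_le_of_diagonal {ι H : Type*} [NormedAddCommGroup H] [InnerProductSpace ℂ H]
    (b : HilbertBasis ι ℂ H) {μ : ι → ℝ} {u w : H} {t : ℝ}
    (hw : ∀ n, inner ℂ (b n) w = μ n * inner ℂ (b n) u)
    (h0 : ∀ n, t < μ n → inner ℂ (b n) u = 0) :
    (inner ℂ u w).re ≤ t * ‖u‖ ^ 2 := by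
  by_contra! hlt
  by_cases hu : u = 0
  · simp [hu] at hlt
  have h := HilbertBasis.hasSum_norm_sq b u
  have h1 := HilbertBasis.hasSum_re_inner b hw
  refine absurd (hasSum_le (fun n => ?_) h1 (h.mul_left t)) (not_le.2 hlt)
  rcases lt_or_ge t (μ n) with hn | hn
  · simp [h0 n hn]
  · gcongr

/-- The span of finitely many sine products is a trial space for the Schrödinger operator. -/
theorem re_inner_schrodinger_le (hL : 0 < L) (hd : 0 < d) (hv0 : ∀ᵐ x ∂volume, 0 ≤ v x)
    (hv : MemLp v ∞ volume) (hv1 : MemLp v 1 volume) (T : Finset (Fin d → ℕ)) {m : ℝ}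
    (hm : ∀ k ∈ T, dirichletEigenvalue L k ≤ m) (u : (schrodinger d L v hv).domain)
    (hu : (u : L2 (cube d L)) ∈
      Submodule.span ℂ (Set.range fun k : T => mode L (fun _ => false) (k : Fin d → ℕ))) :
    (inner ℂ (u : L2 (cube d L)) (schrodinger d L v hv u)).re
      ≤ (m + T.card * (2 / L) ^ d * ∫ x, ‖v x‖) * ‖(u : L2 (cube d L))‖ ^ 2 := by
  have hdiag := isDiagonalAdd_schrodinger hL hd hv0 hv
  set b := sineBasis d hL with hb
  set V := mulPotentialCLM (cube d L) v hv with hV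
  have hbm : ∀ k, b k = mode L (fun _ => false) k := sineBasis_apply hL
  obtain ⟨c, hc⟩ := (Submodule.mem_span_range_iff_exists_fun ℂ).1 hu
  have hon := orthonormal_iff_ite.1 (orthonormal_mode (d := d) hL fun _ => false)
  have hcoef : ∀ k, inner ℂ (b k) (u : L2 (cube d L)) = if h : k ∈ T then c ⟨k, h⟩ else 0 := by
    intro k
    rw [← hc, inner_sum, hbm]
    simp only [inner_smul_right, hon, mul_ite, mul_one, mul_zero]
    split_ifs with h
    · rw [Finset.sum_eq_single ⟨k, h⟩]
      · simp
      · intro j _ hj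
        rw [if_neg fun e => hj (Subtype.ext e.symm)]
      · intro hnot
        exact absurd (Finset.mem_univ _) hnot
    · refine Finset.sum_eq_zero fun j _ => ?_
      rw [if_neg fun e : k = j => h (by rw [e]; exact j.2)]
  have h1 : (inner ℂ (u : L2 (cube d L)) (schrodinger d L v hv u - V u)).re
      ≤ m * ‖(u : L2 (cube d L))‖ ^ 2 := by
    refine re_inner_le_of_diagonal b (μ := dirichletEigenvalue L) (fun k => ?_) fun k hk => ?_
    · rw [inner_sub_right, hdiag.inner_apply, add_sub_cancel_right]
    · rw [hcoef, dif_neg fun h => not_lt.2 (hm k h) hk]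
  have hcsum : ∑ k : T, ‖c k‖ ^ 2 ≤ ‖(u : L2 (cube d L))‖ ^ 2 := by
    have h2 := b.orthonormal.sum_inner_products_le (u : L2 (cube d L)) (s := T)
    rw [← Finset.sum_coe_sort] at h2
    refine le_trans (le_of_eq (Finset.sum_congr rfl fun k _ => ?_)) h2
    rw [hcoef, dif_pos k.2]
  -- Cauchy–Schwarz on the coefficients and the sup bound on the modes; against `v` in `L¹` this
  -- bounds the potential energy.
  have hpt : ∀ᵐ x ∂(volume.restrict (cube d L)), ‖(u : L2 (cube d L)) x‖ ^ 2
      ≤ T.card * (2 / L) ^ d * ‖(u : L2 (cube d L))‖ ^ 2 := by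
    have hux : ∀ᵐ x ∂(volume.restrict (cube d L)), (u : L2 (cube d L)) x
        = ∑ k : T, c k * modeFn L (fun _ => false) (fun j => (k : Fin d → ℕ) j + 1) x := by
      have h2 : ∀ᵐ x ∂(volume.restrict (cube d L)), ∀ k : T,
          (c k • mode L (fun _ => false) (k : Fin d → ℕ)) x
            = c k * modeFn L (fun _ => false) (fun j => (k : Fin d → ℕ) j + 1) x := by
        refine ae_all_iff.2 fun k => ?_
        filter_upwards [Lp.coeFn_smul (c k) (mode L (fun _ => false) (k : Fin d → ℕ)),
          coeFn_mode L (fun _ => false) (k : Fin d → ℕ)] with x hx hx'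
        rw [hx, Pi.smul_apply, hx', smul_eq_mul]
      have h3 := Lp.coeFn_fun_finsetSum (Finset.univ : Finset T)
        (fun k => c k • mode L (fun _ => false) (k : Fin d → ℕ))
      rw [hc] at h3
      filter_upwards [h2, h3] with x hx hx'
      rw [hx']
      exact Finset.sum_congr rfl fun k _ => hx k
    filter_upwards [hux] with x hx
    have h4 : ‖(u : L2 (cube d L)) x‖ ≤ √(2 / L) ^ d * ∑ k : T, ‖c k‖ := by
      rw [hx, Finset.mul_sum]
      refine (norm_sum_le _ _).trans (Finset.sum_le_sum fun k _ => ?_)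
      rw [norm_mul, mul_comm]
      exact mul_le_mul_of_nonneg_right (norm_modeFn_le _ _ _ _) (norm_nonneg _)
    have h5 : (∑ k : T, ‖c k‖) ^ 2 ≤ T.card * ∑ k : T, ‖c k‖ ^ 2 := by
      have := sq_sum_le_card_mul_sum_sq (s := (Finset.univ : Finset T)) (f := fun k => ‖c k‖)
      simpa using this
    have h6 : (√(2 / L) ^ d) ^ 2 = (2 / L) ^ d := by
      rw [← pow_mul, mul_comm, pow_mul, Real.sq_sqrt (by positivity)]
    calc ‖(u : L2 (cube d L)) x‖ ^ 2 ≤ (√(2 / L) ^ d * ∑ k : T, ‖c k‖) ^ 2 := by gcongr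
      _ = (2 / L) ^ d * (∑ k : T, ‖c k‖) ^ 2 := by rw [mul_pow, h6]
      _ ≤ (2 / L) ^ d * (T.card * ‖(u : L2 (cube d L))‖ ^ 2) := by
          gcongr
          exact h5.trans (by gcongr)
      _ = _ := by ring
  have h2 := re_inner_mulPotential_le hv hv1 hpt (by positivity)
  rw [inner_sub_right, Complex.sub_re] at h1
  nlinarith

theorem exists_eigenvalue_schrodinger (hL : 0 < L) (hd : 0 < d) (hv0 : ∀ᵐ x ∂volume, 0 ≤ v x)
    (hv : MemLp v ∞ volume) (hv1 : MemLp v 1 volume) (T : Finset (Fin d → ℕ)) {m : ℝ} {n : ℕ}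
    (hT : T.card = n + 1) (hm : ∀ k ∈ T, dirichletEigenvalue L k ≤ m) :
    ∃ lam ≤ m + T.card * (2 / L) ^ d * ∫ x, ‖v x‖,
      IsNthEigenvalue (schrodinger d L v hv) n lam := by
  refine (isDiagonalAdd_schrodinger hL hd hv0 hv).exists_isNthEigenvalue
    (Submodule.span ℂ (Set.range fun k : T => mode L (fun _ => false) (k : Fin d → ℕ))) ?_ ?_
    (re_inner_schrodinger_le hL hd hv0 hv hv1 T hm)
  · have hli := (orthonormal_mode (d := d) hL fun _ => false).linearIndependent
    have hli2 : LinearIndependent ℂ fun k : T => mode L (fun _ => false) (k : Fin d → ℕ) :=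
      hli.comp (fun k : T => (k : Fin d → ℕ)) Subtype.val_injective
    rw [finrank_span_eq_card hli2, Fintype.card_coe, hT]
  · rw [Submodule.span_le]
    rintro _ ⟨k, rfl⟩
    -- A mode satisfies the coefficient criterion with `f` its own multiple by the eigenvalue.
    refine mem_domain_of_coeff hL (f := (dirichletEigenvalue L (k : Fin d → ℕ) : ℂ) •
      mode L (fun _ => false) (k : Fin d → ℕ)) fun j => ?_
    rw [inner_smul_right, orthonormal_iff_ite.1 (orthonormal_mode (d := d) hL fun _ => false)]
    split_ifs with h
    · rw [h]
    · simp

theorem dirichletEigenvalue_zero (L : ℝ) :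
    dirichletEigenvalue L (0 : Fin d → ℕ) = d * Real.pi ^ 2 / L ^ 2 := by
  simp [dirichletEigenvalue, div_pow, mul_div_assoc]

theorem dirichletEigenvalue_single (L : ℝ) (i : Fin d) :
    dirichletEigenvalue L (Pi.single i 1 : Fin d → ℕ) = (d + 3) * Real.pi ^ 2 / L ^ 2 := by
  have e : ∀ j, (((Pi.single i 1 : Fin d → ℕ) j + 1 : ℕ) * Real.pi / L) ^ 2
      = (Real.pi / L) ^ 2 + if j = i then 3 * (Real.pi / L) ^ 2 else 0 := by
    intro j
    by_cases h : j = i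
    · subst h
      simp
      ring
    · simp [h]
  rw [dirichletEigenvalue, Finset.sum_congr rfl fun j _ => e j, Finset.sum_add_distrib]
  simp
  ring

/-- The eigenvalue is increasing in every `k j`, and a nonzero `k` dominates some unit vector. -/
theorem le_dirichletEigenvalue (L : ℝ) {k : Fin d → ℕ} (hk : k ≠ 0) :
    (d + 3) * Real.pi ^ 2 / L ^ 2 ≤ dirichletEigenvalue L k := by
  obtain ⟨i, hi⟩ := Function.ne_iff.1 hk
  rw [← dirichletEigenvalue_single L i]
  refine Finset.sum_le_sum fun j _ => ?_
  have h : (Pi.single i 1 : Fin d → ℕ) j ≤ k j := by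
    by_cases h : j = i
    · subst h
      simpa using Nat.one_le_iff_ne_zero.2 hi
    · simp [h]
  rw [div_pow, div_pow, mul_pow, mul_pow]
  gcongr

end Schrodinger

end SpectralGap

/-! ### The two-sided gap estimate -/

theorem mainTheorem6 (d : ℕ) (hd : 3 ≤ d) (v : EuclideanSpace ℝ (Fin d) → ℝ)
    (hv_nonneg : ∀ᵐ x ∂(volume : Measure (EuclideanSpace ℝ (Fin d))), 0 ≤ v x)
    (hv_one : MemLp v 1 volume) (hv_top : MemLp v ∞ volume) :
    ∃ α β : ℝ, 0 < α ∧ 0 < β ∧ ∃ L₀ : ℝ, 0 < L₀ ∧ ∀ L : ℝ, L₀ ≤ L →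
      ∃ lam₀ lam₁ : ℝ,
        SpectralGap.IsNthEigenvalue (SpectralGap.schrodinger d L v hv_top) 0 lam₀ ∧
        SpectralGap.IsNthEigenvalue (SpectralGap.schrodinger d L v hv_top) 1 lam₁ ∧
        α / L ^ 2 ≤ lam₁ - lam₀ ∧ lam₁ - lam₀ ≤ β / L ^ 2 := by
  set N := ∫ x, ‖v x‖ with hN
  have hN0 : 0 ≤ N := integral_nonneg fun _ => norm_nonneg _
  set Q := 2 ^ d * N with hQ
  have hQ0 : 0 ≤ Q := by positivity
  refine ⟨1, (d + 3) * Real.pi ^ 2 + 2, one_pos, by positivity, max 1 Q, by positivity,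
    fun L hL => ?_⟩
  have hL1 : 1 ≤ L := (le_max_left _ _).trans hL
  have hLQ : Q ≤ L := (le_max_right _ _).trans hL
  have hL0 : 0 < L := by linarith
  have hd0 : 0 < d := by omega
  have hdiag := SpectralGap.isDiagonalAdd_schrodinger hL0 hd0 hv_nonneg hv_top
  -- Here `d ≥ 3` enters: one power of `L` beyond `L ^ 2` is available to absorb `Q`.
  have hpot : (2 / L) ^ d * N ≤ 1 / L ^ 2 := by
    have h3 : L ^ 3 ≤ L ^ d := pow_le_pow_right₀ hL1 hd
    calc (2 / L) ^ d * N = Q / L ^ d := by rw [div_pow, hQ]; ring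
      _ ≤ L / L ^ 3 := by gcongr
      _ = 1 / L ^ 2 := by field_simp
  obtain ⟨lam₀, h0le, h0⟩ := SpectralGap.exists_eigenvalue_schrodinger hL0 hd0 hv_nonneg hv_top
    hv_one {0} (n := 0) (m := d * Real.pi ^ 2 / L ^ 2) (by simp)
    (by simp [SpectralGap.dirichletEigenvalue_zero])
  let s : Fin d → ℕ := Pi.single ⟨0, hd0⟩ 1
  have hs : (0 : Fin d → ℕ) ≠ s := by
    intro h
    have := congrFun h ⟨0, hd0⟩
    simp [s] at this
  obtain ⟨lam₁, h1le, h1⟩ := SpectralGap.exists_eigenvalue_schrodinger hL0 hd0 hv_nonneg hv_top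
    hv_one {0, s} (n := 1) (m := (d + 3) * Real.pi ^ 2 / L ^ 2) (Finset.card_pair hs) (by
      intro k hk
      rcases Finset.mem_insert.1 hk with rfl | hk
      · rw [SpectralGap.dirichletEigenvalue_zero]
        gcongr
        linarith
      · rw [Finset.mem_singleton.1 hk]
        exact (SpectralGap.dirichletEigenvalue_single L _).le)
  -- This crude bound suffices, since the upper estimate of the gap needs only the order `1 / L ^
  -- 2`.
  have h0ge : 0 ≤ lam₀ := by
    refine hdiag.le_of_isNthEigenvalue h0 ?_
    have : {k : Fin d → ℕ | SpectralGap.dirichletEigenvalue L k < 0} = ∅ :=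
      Set.eq_empty_of_forall_notMem fun k hk =>
        absurd hk (not_lt.2 (SpectralGap.dirichletEigenvalue_nonneg L k))
    rw [this, Set.ncard_empty]
  have h1ge : (d + 3) * Real.pi ^ 2 / L ^ 2 ≤ lam₁ := by
    refine hdiag.le_of_isNthEigenvalue h1 ?_
    refine (Set.ncard_le_ncard (t := {(0 : Fin d → ℕ)}) (fun k hk => ?_)
      (Set.finite_singleton _)).trans (Set.ncard_singleton _).le
    by_contra hne
    exact absurd hk (not_lt.2 (SpectralGap.le_dirichletEigenvalue L hne))
  refine ⟨lam₀, lam₁, h0, h1, ?_, ?_⟩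
  · rw [Finset.card_singleton, ← hN, Nat.cast_one, one_mul] at h0le
    -- One of the two units `1 / L ^ 2` pays for the potential energy in the bound on `lam₀`; the
    -- other is `α = 1`.
    have hgap : 2 * (1 / L ^ 2) ≤ (d + 3) * Real.pi ^ 2 / L ^ 2 - d * Real.pi ^ 2 / L ^ 2 := by
      have e : (d + 3) * Real.pi ^ 2 / L ^ 2 - d * Real.pi ^ 2 / L ^ 2
          = 3 * Real.pi ^ 2 * (1 / L ^ 2) := by ring
      rw [e]
      gcongr
      nlinarith [Real.pi_gt_three]
    linarith
  · rw [Finset.card_pair hs, ← hN, mul_assoc] at h1le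
    have e : ((d + 3) * Real.pi ^ 2 + 2) / L ^ 2
        = (d + 3) * Real.pi ^ 2 / L ^ 2 + 2 * (1 / L ^ 2) := by ring
    rw [e]
    push_cast at h1le
    linarith
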